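/- Let $\mathsf k$ be a field and let $r,q\ge 1$ be integers. Let $\mathcal N^r_q$ be the set of $(a_1,\dots,a_q)\in\mathbb Z_{\ge 0}^q$ with $a_1+\cdots+a_q=r$, let $s=\lceil r/2\rceil$, and let $\mathbb L^r_q$ be the simplicial complex with vertex set $\mathcal N^r_q$ whose faces are all subsets of the sets $$F^r_i=\{a\in\mathcal N^r_q : a_i\le\max\{r-1,s\},\ a_j\le s \text{ for all } j\ne i\},\qquad G^r_i=\{a\in\mathcal N^r_q : a_i\ge r-1\}\qquad(1\le i\le q).$$ If $I$ is an ideal of a polynomial ring $S=\mathsf k[x_1,\dots,x_n]$ minimally generated by square-free monomials $m_1,\dots,m_q$, label each vertex $a$ of $\mathbb L^r_q$ with the monomial $m_1^{a_1}\cdots m_q^{a_q}$ and each face $\sigma$ with the least common multiple $M_\sigma$ of the labels of its vertices. Fix a total order on the vertices. One says that $\mathbb L^r_q$ supports a minimal free resolution of $I^r$ if the homogenized simplicial chain complex is a minimal free resolution of $I^r$; that is, the complex of free $S$-modules whose term in degree $t\ge 0$ has a basis of elements $e_\sigma$, one for each face $\sigma$ with $|\sigma|=t+1$, with differential $$\partial(e_{\sigma})=\sum_{j=0}^{t}(-1)^j\frac{M_\sigma}{M_{\sigma\smallsetminus\{v_j\}}}\,e_{\sigma\smallsetminus\{v_j\}}\qquad(\sigma=\{v_0<\cdots<v_t\},\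 t\ge 1),$$ together with the augmentation $e_{\{v\}}\mapsto M_{\{v\}}$ onto $I^r$, is exact, and for each $t$ its $t$-th module has the smallest rank among the $t$-th modules of all free resolutions $0\to S^{\beta_p}\to\cdots\to S^{\beta_0}\to I^r\to 0$ of $I^r$. Then there exist $n\ge 0$ and an ideal $I$ of $\mathsf k[x_1,\dots,x_n]$ minimally generated by $q$ square-free monomials such that $\mathbb L^r_q$ supports a minimal free resolution of $I^r$ if and only if one of the following holds: - $q=1$ and $r\ge 1$; - $q=2$ and $1\le r\le 4$; - $q\ge 3$ and $1\le r\le 2$. -/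

import Mathlib

open MvPolynomial

noncomputable section

namespace SimplicialPowers

section FreeResolutions

variable {S : Type*} [CommRing S]

/-- The sequence `⋯ → F 2 → F 1 → F 0 → I → 0` of `S`-modules is a free resolution of the ideal
`I`, of finite length and with finitely generated free modules. The last map is given as the map
`ε : F 0 → S` whose image is `I`. -/
structure IsFreeResolution (I : Ideal S) (F : ℕ → Type*) [∀ j, AddCommGroup (F j)]
    [∀ j, Module S (F j)] (d : ∀ j, F (j + 1) →ₗ[S] F j) (ε : F 0 →ₗ[S] S) : Prop where
  free : ∀ j, Module.Free S (F j)
  finite : ∀ j, Module.Finite S (F j)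
  bounded : ∃ t : ℕ, ∀ j, t < j → Subsingleton (F j)
  range_eq : LinearMap.range ε = I
  exact_zero : Function.Exact (d 0) ε
  exact_succ : ∀ j, Function.Exact (d (j + 1)) (d j)

/-- A free resolution of `I` is minimal when, for every `j`, the rank of its `j`-th module is the
smallest one among the ranks of the `j`-th modules of all free resolutions
`0 → S ^ β t → ⋯ → S ^ β 1 → S ^ β 0 → I → 0`. -/
structure IsMinimalFreeResolution (I : Ideal S) (F : ℕ → Type*) [∀ j, AddCommGroup (F j)]
    [∀ j, Module S (F j)] (d : ∀ j, F (j + 1) →ₗ[S] F j) (ε : F 0 →ₗ[S] S) : Prop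
    extends IsFreeResolution I F d ε where
  rank_le : ∀ (β : ℕ → ℕ) (d' : ∀ j, (Fin (β (j + 1)) → S) →ₗ[S] (Fin (β j) → S))
    (ε' : (Fin (β 0) → S) →ₗ[S] S),
    IsFreeResolution I (fun j => Fin (β j) → S) d' ε' → ∀ j, Module.finrank S (F j) ≤ β j

end FreeResolutions

section Homogenization

variable {V : Type*} [LinearOrder V] {n : ℕ}

/-- The exponent vector of the label `M_σ = lcm (m_v : v ∈ σ)` of a face `σ`, where the vertex `v`
is labeled with the monomial `m_v` of exponent vector `label v`. -/
def faceLabel (label : V → Fin n →₀ ℕ) (σ : Finset V) : Fin n →₀ ℕ :=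
  σ.sup label

/-- The faces of dimension `t` of a simplicial complex. -/
abbrev FaceOfDim (Δ : PreAbstractSimplicialComplex V) (t : ℕ) : Type _ :=
  {σ : Finset V // σ ∈ Δ.faces ∧ σ.card = t + 1}

/-- The face `σ \ {v}` of a face `σ` of positive dimension. -/
def FaceOfDim.erase {Δ : PreAbstractSimplicialComplex V} {t : ℕ} (σ : FaceOfDim Δ (t + 1))
    (v : V) (hv : v ∈ σ.1) : FaceOfDim Δ t :=
  have hcard : (σ.1.erase v).card = t + 1 := by
    rw [Finset.card_erase_of_mem hv, σ.2.2, Nat.add_sub_cancel]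
  ⟨σ.1.erase v, (Δ.isRelLowerSet_faces σ.2.1).2 (Finset.erase_subset v σ.1)
    (Finset.card_pos.mp (by rw [hcard]; exact Nat.succ_pos t)), hcard⟩

variable (k : Type*) [Field k]

/-- The free module with basis `e_σ`, for `σ` a face of dimension `t`, over
`k[x_1, …, x_n]`. -/
abbrev ChainModule (n : ℕ) (Δ : PreAbstractSimplicialComplex V) (t : ℕ) : Type _ :=
  FaceOfDim Δ t →₀ MvPolynomial (Fin n) k

/-- The homogenized simplicial boundary map,
`∂ e_σ = ∑_j (-1) ^ j * (M_σ / M_{σ \ {v_j}}) e_{σ \ {v_j}}` for `σ = {v_0 < ⋯ < v_t}`: the index of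
a vertex `v` of `σ` is the number of vertices of `σ` below it. -/
def boundary (label : V → Fin n →₀ ℕ) (Δ : PreAbstractSimplicialComplex V) (t : ℕ) :
    ChainModule k n Δ (t + 1) →ₗ[MvPolynomial (Fin n) k] ChainModule k n Δ t :=
  Finsupp.linearCombination (MvPolynomial (Fin n) k) fun σ =>
    ∑ v ∈ σ.1.attach,
      Finsupp.single (σ.erase v.1 v.2)
        ((-1) ^ (σ.1.filter (· < v.1)).card *
          monomial (faceLabel label σ.1 - faceLabel label (σ.1.erase v.1)) 1)

/-- The augmentation: it sends the basis element of a vertex to the monomial label of that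
vertex. -/
def augmentation (label : V → Fin n →₀ ℕ) (Δ : PreAbstractSimplicialComplex V) :
    ChainModule k n Δ 0 →ₗ[MvPolynomial (Fin n) k] MvPolynomial (Fin n) k :=
  Finsupp.linearCombination (MvPolynomial (Fin n) k) fun σ => monomial (faceLabel label σ.1) 1

/-- The labeled complex `Δ` supports a minimal free resolution of `I`: the homogenization of its
simplicial chain complex is a minimal free resolution of `I`. (It is multigraded by construction,
with `e_σ` in multidegree `M_σ`.) -/
def SupportsMinimalFreeResolution (label : V → Fin n →₀ ℕ) (Δ : PreAbstractSimplicialComplex V)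
    (I : Ideal (MvPolynomial (Fin n) k)) : Prop :=
  IsMinimalFreeResolution I (ChainModule k n Δ) (boundary k label Δ) (augmentation k label Δ)

end Homogenization

section TheComplex

/-- `N r q`: the points of `ℕ ^ q` whose coordinates add up to `r`. -/
@[ext]
structure N (r q : ℕ) where
  coord : Fin q → ℕ
  sum_eq : ∑ i, coord i = r

/-- The vertices are ordered lexicographically (this order only enters the signs of the boundary
maps). -/
instance (r q : ℕ) : LinearOrder (N r q) :=
  LinearOrder.lift' (fun a : N r q => toLex a.coord) fun _ _ h => N.ext (toLex.injective h)

/-- The set `F_i ^ r`, in which `s = ⌈r / 2⌉` is written `(r + 1) / 2`. -/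
def firstLayer (r q : ℕ) (i : Fin q) : Set (N r q) :=
  {a | a.coord i ≤ max (r - 1) ((r + 1) / 2) ∧ ∀ j, j ≠ i → a.coord j ≤ (r + 1) / 2}

/-- The set `G_i ^ r = {(r - 1) e_i + e_j}` (for `1 ≤ r`). -/
def secondLayer (r q : ℕ) (i : Fin q) : Set (N r q) :=
  {a | r - 1 ≤ a.coord i}

/-- The simplicial complex `𝕃 ^ r _ q`: its faces are the (nonempty) subsets of the sets `F_i ^ r`
and `G_i ^ r`. -/
def L (r q : ℕ) : PreAbstractSimplicialComplex (N r q) where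
  faces := {σ | σ.Nonempty ∧
    ∃ i : Fin q, (σ : Set (N r q)) ⊆ firstLayer r q i ∨ (σ : Set (N r q)) ⊆ secondLayer r q i}
  isRelLowerSet_faces := by
    rintro σ ⟨hσ, i, hi⟩
    refine ⟨hσ, fun τ hτσ hτ => ⟨hτ, i, ?_⟩⟩
    have h : (τ : Set (N r q)) ⊆ σ := Finset.coe_subset.mpr hτσ
    exact hi.imp h.trans h.trans

end TheComplex

section MonomialIdeals

/-- The ideal `I` of `k[x_1, …, x_n]` is minimally generated by `q` square-free monomials, those
with exponent vectors `m 0, …, m (q - 1)`. -/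
structure IsMinimallyGenerated {k : Type*} [Field k] {n q : ℕ} (I : Ideal (MvPolynomial (Fin n) k))
    (m : Fin q → Fin n →₀ ℕ) : Prop where
  squarefree : ∀ i x, m i x ≤ 1
  span_eq : Ideal.span (Set.range fun i => monomial (m i) (1 : k)) = I
  minimal : ∀ i, Ideal.span ((fun j => monomial (m j) (1 : k)) '' {i}ᶜ) ≠ I

/-- The vertex `a` of `𝕃 ^ r _ q` is labeled with `m_1 ^ a_1 ⋯ m_q ^ a_q`. -/
def powerLabel {n q : ℕ} (m : Fin q → Fin n →₀ ℕ) (r : ℕ) (a : N r q) : Fin n →₀ ℕ :=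
  ∑ i, a.coord i • m i

end MonomialIdeals

end SimplicialPowers

end

/-! Necessity. Labels are additive in the vertex, so if `v` is the midpoint of `w₁` and `w₂`, its
label divides the lcm of theirs (`powerLabel_le_sup`). When the three lie in one face, the triangle
and its edge opposite `v` have equal labels, and the differential from degree 2 to degree 1 has an
entry ±1. Cancelling this entry gives a resolution of strictly smaller rank in degree 2
(`IsMinimalFreeResolution.not_isUnit_coord`). For any monomial labels, such a face exists when `q =
2`, `r ≥ 5` and when `q ≥ 3`, `r ≥ 3`.

Sufficiency. The extremal ideal has one variable for each subset `A` of the indices, and its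
exponent in the label of `a` is the sum of `a_i` over `i ∈ A`. Two things are needed.

Exactness: the homogenized complex splits by multidegree `u` into the augmented chain complexes of
the subcomplexes induced on the vertices whose label divides `u`. Each nonempty one is acyclic
because deleting dominated vertices reduces it to a cone (`Dismantlable.exists_simplexBoundary_eq`).

Minimality: each vertex of a face is the unique maximum over that face of some such sum, so deleting
it lowers the label. All entries of the differentials then have zero constant term, and comparison
with another resolution modulo these polynomials bounds the ranks (`IsFreeResolution.finrank_le`).

In the surviving cases the complex is small: a point for `q = 1`, a simplex for `r = 1`, a simplex
with a further simplex at each `2 e_i` for `r = 2`, and a path for `q = 2`, `r = 3, 4`. -/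

open MvPolynomial

noncomputable section

namespace SimplicialPowers

/-! ### Comparing free resolutions modulo a proper ideal -/

section Comparison

variable {S : Type*} [CommRing S]

/-- A linear map out of a projective module lifts along a linear map whose range contains its
range. -/
theorem exists_lift_of_range_le {P M N : Type*} [AddCommGroup P] [Module S P] [AddCommGroup M]
    [Module S M] [AddCommGroup N] [Module S N] [Module.Projective S P] (p : M →ₗ[S] N)
    (f : P →ₗ[S] N) (h : ∀ x, f x ∈ LinearMap.range p) :
    ∃ g : P →ₗ[S] M, ∀ x, p (g x) = f x := by
  obtain ⟨g, hg⟩ := Module.projective_lifting_property p.rangeRestrict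
    (f.codRestrict (LinearMap.range p) h) p.surjective_rangeRestrict
  refine ⟨g, fun x => ?_⟩
  have := LinearMap.congr_fun hg x
  simpa using congrArg Subtype.val this

/-- A linear endomorphism that is congruent to the identity modulo a proper ideal does not factor
through a free module of smaller rank. -/
theorem finrank_le_of_comp_sub_id_mem {M N : Type*} [AddCommGroup M] [Module S M] [AddCommGroup N]
    [Module S N] [Module.Free S M] [Module.Finite S M] [Module.Free S N] [Module.Finite S N]
    {J : Ideal S} (hJ : J ≠ ⊤) (f : M →ₗ[S] N) (g : N →ₗ[S] M)
    (h : ∀ x, g (f x) - x ∈ J • (⊤ : Submodule S M)) :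
    Module.finrank S M ≤ Module.finrank S N := by
  classical
  have : Nontrivial (S ⧸ J) := Ideal.Quotient.nontrivial_iff.mpr hJ
  have : Nontrivial S := (Ideal.Quotient.mk J).domain_nontrivial
  let b := Module.finBasis S M
  let c := Module.finBasis S N
  let A := (LinearMap.toMatrix b c f).map (Ideal.Quotient.mk J)
  let B := (LinearMap.toMatrix c b g).map (Ideal.Quotient.mk J)
  have hBA : B * A = 1 := by
    have h1 : LinearMap.toMatrix c b g * LinearMap.toMatrix b c f
        = LinearMap.toMatrix b b (g ∘ₗ f) := (LinearMap.toMatrix_comp b c b g f).symm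
    ext i j
    have h2 : b.repr (g (f (b j)) - b j) i ∈ J := by
      have h3 : (b.coord i) (g (f (b j)) - b j) ∈ (J • (⊤ : Submodule S M)).map (b.coord i) :=
        Submodule.mem_map_of_mem (h _)
      rw [Submodule.map_smul''] at h3
      have h4 := Submodule.smul_mono (le_refl J)
        (le_top : (⊤ : Submodule S M).map (b.coord i) ≤ ⊤) h3
      simpa using h4
    have h5 : (B * A) i j = Ideal.Quotient.mk J (b.repr (g (f (b j))) i) := by
      have : B * A = (LinearMap.toMatrix b b (g ∘ₗ f)).map (Ideal.Quotient.mk J) := by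
        rw [← h1, Matrix.map_mul]
      rw [this]
      simp [LinearMap.toMatrix_apply]
    rw [h5]
    have h6 : Ideal.Quotient.mk J (b.repr (g (f (b j))) i) = Ideal.Quotient.mk J (b.repr (b j) i) := by
      rw [Ideal.Quotient.eq]
      simpa using h2
    rw [h6, Module.Basis.repr_self, Matrix.one_apply, Finsupp.single_apply]
    by_cases hij : i = j
    · simp [hij]
    · simp [hij, Ne.symm hij]
  -- Over a nontrivial commutative ring, a left-invertible matrix has at least as many rows as
  -- columns.
  have hinj : Function.Injective (Matrix.mulVecLin A) := by
    refine Function.LeftInverse.injective (g := Matrix.mulVecLin B) fun x => ?_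
    simp [Matrix.mulVec_mulVec, hBA]
  have := card_le_of_injective (S ⧸ J) (Matrix.mulVecLin A) hinj
  simpa using this

variable {I : Ideal S}
  {F : ℕ → Type*} [∀ j, AddCommGroup (F j)] [∀ j, Module S (F j)]
  {d : ∀ j, F (j + 1) →ₗ[S] F j} {ε : F 0 →ₗ[S] S}
  {G : ℕ → Type*} [∀ j, AddCommGroup (G j)] [∀ j, Module S (G j)]
  {d' : ∀ j, G (j + 1) →ₗ[S] G j} {ε' : G 0 →ₗ[S] S}

/-- Comparison of a free resolution with differentials in a proper ideal with another one: in each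
degree there are maps back and forth whose composition is the identity modulo that ideal. -/
theorem IsFreeResolution.exists_comparison (hF : IsFreeResolution I F d ε)
    (hG : IsFreeResolution I G d' ε') {J : Ideal S}
    (hmin : ∀ j x, d j x ∈ J • (⊤ : Submodule S (F j))) (j : ℕ) :
    ∃ (f : F j →ₗ[S] G j) (g : G j →ₗ[S] F j) (h : F j →ₗ[S] F (j + 1)),
      (∀ x, f (d j x) ∈ LinearMap.range (d' j)) ∧ (∀ x, g (d' j x) ∈ LinearMap.range (d j)) ∧
      (∀ x, g (f (d j x)) - d j x = d j (h (d j x))) ∧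
      ∀ x, g (f x) - x ∈ J • (⊤ : Submodule S (F j)) := by
  have := hF.free
  have := hG.free
  induction j with
  | zero =>
    have hε : ∀ x, ε (d 0 x) = 0 := fun x => hF.exact_zero.apply_apply_eq_zero x
    have hε' : ∀ x, ε' (d' 0 x) = 0 := fun x => hG.exact_zero.apply_apply_eq_zero x
    obtain ⟨f, hf⟩ := exists_lift_of_range_le ε' ε fun x => by
      rw [hG.range_eq, ← hF.range_eq]; exact ⟨x, rfl⟩
    obtain ⟨g, hg⟩ := exists_lift_of_range_le ε ε' fun x => by
      rw [hF.range_eq, ← hG.range_eq]; exact ⟨x, rfl⟩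
    obtain ⟨h, hh⟩ := exists_lift_of_range_le (d 0) (g ∘ₗ f - LinearMap.id) fun x =>
      (hF.exact_zero _).1 (by simp [hf, hg])
    simp only [LinearMap.sub_apply, LinearMap.comp_apply, LinearMap.id_apply] at hh
    exact ⟨f, g, h, fun x => (hG.exact_zero _).1 (by rw [hf, hε]),
      fun x => (hF.exact_zero _).1 (by rw [hg, hε']), fun x => (hh _).symm,
      fun x => hh x ▸ hmin 0 _⟩
  | succ j ih =>
    obtain ⟨f, g, h, hf, hg, hh, -⟩ := ih
    have hd : ∀ x, d j (d (j + 1) x) = 0 := fun x => (hF.exact_succ j).apply_apply_eq_zero x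
    have hd' : ∀ x, d' j (d' (j + 1) x) = 0 := fun x => (hG.exact_succ j).apply_apply_eq_zero x
    obtain ⟨f₁, hf₁⟩ := exists_lift_of_range_le (d' j) (f ∘ₗ d j) hf
    obtain ⟨g₁, hg₁⟩ := exists_lift_of_range_le (d j) (g ∘ₗ d' j) hg
    simp only [LinearMap.comp_apply] at hf₁ hg₁
    -- The usual homotopy construction: `g₁ f₁ - 1 - h d` lands in cycles, so it lifts through `d (j
    -- + 1)`. The induction carries the homotopy identity only on boundaries, which is all this step
    -- needs.
    obtain ⟨h₁, hh₁⟩ := exists_lift_of_range_le (d (j + 1))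
      (g₁ ∘ₗ f₁ - LinearMap.id - h ∘ₗ d j) fun x => (hF.exact_succ j _).1 (by
        simp [hg₁, hf₁, hh])
    simp only [LinearMap.sub_apply, LinearMap.comp_apply, LinearMap.id_apply] at hh₁
    refine ⟨f₁, g₁, h₁, fun x => (hG.exact_succ j _).1 (by rw [hf₁, hd, map_zero]),
      fun x => (hF.exact_succ j _).1 (by rw [hg₁, hd', map_zero]), fun x => ?_, fun x => ?_⟩
    · rw [hh₁, hd, map_zero, sub_zero]
    -- Both terms of the homotopy contain a differential, so both lie in `J F`.
    · have h1 : g₁ (f₁ x) - x = d (j + 1) (h₁ x) + h (d j x) := by rw [hh₁]; abel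
      rw [h1]
      refine add_mem (hmin _ _) ?_
      have h2 : h (d j x) ∈ (J • (⊤ : Submodule S (F j))).map h :=
        Submodule.mem_map_of_mem (hmin j x)
      rw [Submodule.map_smul''] at h2
      exact Submodule.smul_mono (le_refl J) le_top h2

/-- A free resolution whose differentials take values in `J F` for a proper ideal `J` has the
smallest ranks. -/
theorem IsFreeResolution.finrank_le (hF : IsFreeResolution I F d ε)
    (hG : IsFreeResolution I G d' ε') {J : Ideal S} (hJ : J ≠ ⊤)
    (hmin : ∀ j x, d j x ∈ J • (⊤ : Submodule S (F j))) (j : ℕ) :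
    Module.finrank S (F j) ≤ Module.finrank S (G j) := by
  have := hF.free j
  have := hG.free j
  have := hF.finite j
  have := hG.finite j
  obtain ⟨f, g, -, -, -, -, h⟩ := hF.exists_comparison hG hmin j
  exact finrank_le_of_comp_sub_id_mem hJ f g h

theorem IsFreeResolution.isMinimalFreeResolution [Nontrivial S] (hF : IsFreeResolution I F d ε)
    {J : Ideal S} (hJ : J ≠ ⊤) (hmin : ∀ j x, d j x ∈ J • (⊤ : Submodule S (F j))) :
    IsMinimalFreeResolution I F d ε :=
  { hF with
    rank_le := fun β d' ε' hG j => by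
      simpa using hF.finrank_le hG hJ hmin j }

end Comparison

/-! ### Cancelling a unit entry of a differential -/

section Cancellation

variable {S : Type*} [CommRing S] {I : Ideal S}
  {F : ℕ → Type*} [∀ j, AddCommGroup (F j)] [∀ j, Module S (F j)]
  {d : ∀ j, F (j + 1) →ₗ[S] F j} {ε : F 0 →ₗ[S] S}

/-- A free resolution by free submodules gives a free resolution by standard free modules. -/
theorem IsFreeResolution.exists_standard (hF : IsFreeResolution I F d ε) [Nontrivial S]
    (P : ∀ j, Submodule S (F j)) [∀ j, Module.Free S (P j)] [∀ j, Module.Finite S (P j)]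
    (hdP : ∀ j, ∀ x ∈ P (j + 1), d j x ∈ P j)
    (hε : ∀ x, ∃ y ∈ P 0, ε y = ε x)
    (hP0 : ∀ x ∈ P 0, ε x = 0 → ∃ y ∈ P 1, d 0 y = x)
    (hP : ∀ j, ∀ x ∈ P (j + 1), d j x = 0 → ∃ y ∈ P (j + 2), d (j + 1) y = x) :
    ∃ (d' : ∀ j, (Fin (Module.finrank S (P (j + 1))) → S) →ₗ[S] (Fin (Module.finrank S (P j)) → S))
      (ε' : (Fin (Module.finrank S (P 0)) → S) →ₗ[S] S),
      IsFreeResolution I (fun j => Fin (Module.finrank S (P j)) → S) d' ε' := by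
  let e : ∀ j, P j ≃ₗ[S] (Fin (Module.finrank S (P j)) → S) :=
    fun j => (Module.finBasis S (P j)).equivFun
  have hd0 : ∀ x, ε (d 0 x) = 0 := fun x => hF.exact_zero.apply_apply_eq_zero x
  have hd : ∀ j x, d j (d (j + 1) x) = 0 := fun j x => (hF.exact_succ j).apply_apply_eq_zero x
  refine ⟨fun j => (e j).toLinearMap ∘ₗ (d j).restrict (hdP j) ∘ₗ (e (j + 1)).symm.toLinearMap,
    ε ∘ₗ (P 0).subtype ∘ₗ (e 0).symm.toLinearMap, ?_⟩
  refine ⟨fun j => inferInstance, fun j => inferInstance, ?_, ?_, ?_, ?_⟩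
  · obtain ⟨t, ht⟩ := hF.bounded
    refine ⟨t, fun j hj => ?_⟩
    have := ht j hj
    exact (e j).symm.injective.subsingleton
  · rw [← hF.range_eq]
    ext s
    constructor
    · rintro ⟨x, rfl⟩
      exact ⟨_, rfl⟩
    · rintro ⟨x, rfl⟩
      obtain ⟨y, hy, hyx⟩ := hε x
      exact ⟨e 0 ⟨y, hy⟩, by simp [hyx]⟩
  · intro x
    constructor
    · intro hx
      obtain ⟨y, hy, hyx⟩ := hP0 _ ((e 0).symm x).2 hx
      refine ⟨e 1 ⟨y, hy⟩, ?_⟩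
      simp only [LinearMap.comp_apply, LinearEquiv.coe_coe, LinearEquiv.symm_apply_apply]
      rw [← LinearEquiv.eq_symm_apply]
      exact Subtype.ext hyx
    · rintro ⟨y, rfl⟩
      simp [hd0]
  · intro j x
    constructor
    · intro hx
      simp only [LinearMap.comp_apply, LinearEquiv.coe_coe, LinearEquiv.map_eq_zero_iff] at hx
      obtain ⟨y, hy, hyx⟩ := hP j _ ((e (j + 1)).symm x).2 (congrArg Subtype.val hx)
      refine ⟨e (j + 2) ⟨y, hy⟩, ?_⟩
      simp only [LinearMap.comp_apply, LinearEquiv.coe_coe, LinearEquiv.symm_apply_apply]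
      rw [← LinearEquiv.eq_symm_apply]
      exact Subtype.ext hyx
    · rintro ⟨y, rfl⟩
      simp only [LinearMap.comp_apply, LinearEquiv.coe_coe, LinearEquiv.symm_apply_apply,
        LinearEquiv.map_eq_zero_iff]
      exact Subtype.ext (hd _ _)

/-- The kernel of a functional on a free module taking the value `1` on a basis vector is free, and
its rank is one less. -/
theorem free_ker_of_apply_basis_eq_one [Nontrivial S] {M ι : Type*} [AddCommGroup M] [Module S M]
    [Finite ι] (b : Module.Basis ι S M) (i : ι) (φ : M →ₗ[S] S) (h : φ (b i) = 1) :
    Module.Free S (LinearMap.ker φ) ∧ Module.Finite S (LinearMap.ker φ) ∧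
      Module.finrank S (LinearMap.ker φ) < Module.finrank S M := by
  classical
  have := Fintype.ofFinite ι
  let f : ({j // j ≠ i} → S) →ₗ[S] M := Fintype.linearCombination S
    fun j : {j // j ≠ i} => b j - φ (b j) • b i
  have hf : ∀ x, φ (f x) = 0 := fun x => by
    simp [f, Fintype.linearCombination_apply, h]
  let g : M →ₗ[S] ({j // j ≠ i} → S) := LinearMap.pi fun j => b.coord j
  have hgf : ∀ x, g (f x) = x := fun x => by
    ext j
    have h1 : ∀ l : {j // j ≠ i}, b.repr (b l - φ (b l) • b i) j = if l = j then 1 else 0 := by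
      intro l
      simp [Finsupp.single_apply, j.2.symm, Subtype.ext_iff]
    simp only [f, g, Fintype.linearCombination_apply, LinearMap.pi_apply, Module.Basis.coord_apply,
      map_sum, map_smul, h1]
    simp
  have hfg : ∀ y, φ y = 0 → f (g y) = y := fun y hy => by
    -- The difference has all coordinates other than `i` zero, so it is a multiple of `b i`; since
    -- `φ (b i) = 1` and `φ` kills it, it vanishes.
    have h1 : g (y - f (g y)) = 0 := by rw [map_sub, hgf, sub_self]
    have h2 : φ (y - f (g y)) = 0 := by rw [map_sub, hf, hy, sub_self]
    have h3 : y - f (g y) = b.repr (y - f (g y)) i • b i := by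
      conv_lhs => rw [← b.sum_repr (y - f (g y))]
      refine Fintype.sum_eq_single i fun j hj => ?_
      have : b.repr (y - f (g y)) j = 0 := congrFun h1 ⟨j, hj⟩
      rw [this, zero_smul]
    have h4 : b.repr (y - f (g y)) i = 0 := by
      rw [h3, map_smul, h, smul_eq_mul, mul_one] at h2
      exact h2
    rw [h4, zero_smul] at h3
    exact (sub_eq_zero.mp h3).symm
  let e : LinearMap.ker φ ≃ₗ[S] ({j // j ≠ i} → S) :=
    LinearEquiv.ofLinearMap (g ∘ₗ (LinearMap.ker φ).subtype) (f.codRestrict _ hf)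
      (LinearMap.ext fun x => hgf x)
      (LinearMap.ext fun y => Subtype.ext (hfg y y.2))
  refine ⟨Module.Free.of_equiv e.symm, Module.Finite.equiv e.symm, ?_⟩
  rw [e.finrank_eq, Module.finrank_eq_card_basis b, Module.finrank_fintype_fun_eq_card]
  exact Fintype.card_subtype_lt (x := i) (by simp)

/-- The submodules of a complex that remain when a functional `φ` in degree `1` is cancelled against
a functional `ψ` in degree `2`. -/
def cancelled (φ : F 1 →ₗ[S] S) (ψ : F 2 →ₗ[S] S) : ∀ j, Submodule S (F j)
  | 0 => ⊤
  | 1 => LinearMap.ker φ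
  | 2 => LinearMap.ker ψ
  | _ + 3 => ⊤

/-- In a minimal free resolution, the differential has no unit entry. -/
theorem IsMinimalFreeResolution.not_isUnit_coord [Nontrivial S]
    (hF : IsMinimalFreeResolution I F d ε) {ι κ : Type*} [Finite ι] [Finite κ]
    (b : Module.Basis ι S (F 1)) (c : Module.Basis κ S (F 2)) (i : ι) (l : κ) :
    ¬ IsUnit (b.coord i (d 1 (c l))) := by
  rintro ⟨u, hu⟩
  have hF' := hF.toIsFreeResolution
  have hfree := hF.free
  have hfin := hF.finite
  let φ : F 1 →ₗ[S] S := b.coord i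
  -- The scaling gives `ψ (c l) = 1`, while `ker ψ` is exactly the set of chains that `d 1` sends
  -- into `ker φ`.
  let ψ : F 2 →ₗ[S] S := (↑u⁻¹ : S) • φ ∘ₗ d 1
  have hψ : ∀ x, ψ x = 0 ↔ φ (d 1 x) = 0 := fun x => by
    simp [ψ]
  obtain ⟨h1, h2, -⟩ := free_ker_of_apply_basis_eq_one b i φ (by simp [φ])
  obtain ⟨h3, h4, h5⟩ := free_ker_of_apply_basis_eq_one c l ψ (by simp [ψ, φ, ← hu])
  let P := cancelled φ ψ
  have hPfree : ∀ j, Module.Free S (P j)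
    | 0 => Module.Free.of_equiv Submodule.topEquiv.symm
    | 1 => h1
    | 2 => h3
    | _ + 3 => Module.Free.of_equiv Submodule.topEquiv.symm
  have hPfin : ∀ j, Module.Finite S (P j)
    | 0 => Module.Finite.equiv Submodule.topEquiv.symm
    | 1 => h2
    | 2 => h4
    | _ + 3 => Module.Finite.equiv Submodule.topEquiv.symm
  have hd : ∀ j x, d j (d (j + 1) x) = 0 := fun j x => (hF.exact_succ j).apply_apply_eq_zero x
  have hP2 : ∀ x, d 1 x = 0 → x ∈ P 2 := fun x hx => (hψ x).2 (by rw [hx, map_zero])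
  have hdP : ∀ j, ∀ x ∈ P (j + 1), d j x ∈ P j := by
    rintro (_ | _ | _ | j) x hx
    · exact Submodule.mem_top
    · exact (hψ x).1 hx
    · exact hP2 _ (hd 1 x)
    · exact Submodule.mem_top
  have hP0 : ∀ x ∈ P 0, ε x = 0 → ∃ y ∈ P 1, d 0 y = x := by
    intro x _ hx
    obtain ⟨y, rfl⟩ := (hF.exact_zero x).1 hx
    -- A boundary with `φ`-value 1: subtracting a multiple moves any preimage into `ker φ` without
    -- changing its image under `d 0`.
    have h6 : φ (d 1 ((↑u⁻¹ : S) • c l)) = 1 := by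
      rw [map_smul, map_smul, ← hu, smul_eq_mul, Units.inv_mul]
    refine ⟨y - φ y • d 1 ((↑u⁻¹ : S) • c l), ?_, ?_⟩
    · change φ _ = 0
      rw [map_sub, map_smul, h6, smul_eq_mul, mul_one, sub_self]
    · rw [map_sub, map_smul, hd, smul_zero, sub_zero]
  have hP : ∀ j, ∀ x ∈ P (j + 1), d j x = 0 → ∃ y ∈ P (j + 2), d (j + 1) y = x := by
    rintro (_ | _ | j) x hx hdx
    · obtain ⟨y, rfl⟩ := (hF.exact_succ 0 x).1 hdx
      exact ⟨y, (hψ y).2 hx, rfl⟩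
    · obtain ⟨y, rfl⟩ := (hF.exact_succ 1 x).1 hdx
      exact ⟨y, Submodule.mem_top, rfl⟩
    · obtain ⟨y, rfl⟩ := (hF.exact_succ (j + 2) x).1 hdx
      exact ⟨y, Submodule.mem_top, rfl⟩
  obtain ⟨d', ε', h⟩ := hF'.exists_standard P hdP (fun x => ⟨x, Submodule.mem_top, rfl⟩) hP0 hP
  exact (hF.rank_le (fun j => Module.finrank S (P j)) d' ε' h 2).not_gt h5

end Cancellation

/-! ### Simplicial chains, cones and dismantlability -/

section Chains

variable {V : Type*} [LinearOrder V] (k : Type*) [Field k]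

/-- The sign with which `v` is removed from, or added to, the face `σ`. -/
def faceSign (σ : Finset V) (v : V) : k :=
  (-1) ^ (σ.filter (· < v)).card

/-- The augmented simplicial boundary of the full simplex on `V`. -/
def simplexBoundary : (Finset V →₀ k) →ₗ[k] (Finset V →₀ k) :=
  Finsupp.linearCombination k fun σ => ∑ v ∈ σ, Finsupp.single (σ.erase v) (faceSign k σ v)

/-- The cone operator with apex `w` on the chains of the full simplex on `V`. -/
def coneOp (w : V) : (Finset V →₀ k) →ₗ[k] (Finset V →₀ k) :=
  Finsupp.linearCombination k fun σ =>
    if w ∈ σ then 0 else Finsupp.single (insert w σ) (faceSign k σ w)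

variable {k}

theorem faceSign_mul_self (σ : Finset V) (v : V) : faceSign k σ v * faceSign k σ v = 1 := by
  rw [faceSign, ← mul_pow]; simp

theorem faceSign_erase_self (σ : Finset V) (v : V) :
    faceSign k (σ.erase v) v = faceSign k σ v := by
  rw [faceSign, faceSign]
  congr 2
  ext x
  simp only [Finset.mem_filter, Finset.mem_erase]
  exact ⟨fun h => ⟨h.1.2, h.2⟩, fun h => ⟨⟨h.2.ne, h.1⟩, h.2⟩⟩

theorem faceSign_insert_self (σ : Finset V) (v : V) :
    faceSign k (insert v σ) v = faceSign k σ v := by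
  rw [← faceSign_erase_self (insert v σ), ← faceSign_erase_self σ]
  simp

theorem faceSign_insert_of_lt {σ : Finset V} {v w : V} (h : v < w) :
    faceSign k (insert w σ) v = faceSign k σ v := by
  rw [faceSign, faceSign, Finset.filter_insert, if_neg h.not_gt]

theorem faceSign_insert_of_gt {σ : Finset V} {v w : V} (h : w < v) (hw : w ∉ σ) :
    faceSign k (insert w σ) v = -faceSign k σ v := by
  rw [faceSign, faceSign, Finset.filter_insert, if_pos h, Finset.card_insert_of_notMem (by simp [hw]),
    pow_succ, mul_neg_one]

/-- Exactly one of `v`, `w` precedes the other, so exactly one of the two signs notices the presence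
of the other vertex. This makes the mixed terms in the homotopy formula cancel. -/
theorem faceSign_anticomm {σ : Finset V} {v w : V} (hv : v ∈ σ) (hw : w ∉ σ) :
    faceSign k σ w * faceSign k (insert w σ) v =
      -(faceSign k σ v * faceSign k (σ.erase v) w) := by
  have hvw : v ≠ w := fun h => hw (h ▸ hv)
  have h1 : insert v (σ.erase v) = σ := Finset.insert_erase hv
  rcases lt_or_gt_of_ne hvw with h | h
  · have h2 : faceSign k σ w = -faceSign k (σ.erase v) w := by
      conv_lhs => rw [← h1]
      exact faceSign_insert_of_gt h (Finset.notMem_erase v σ)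
    rw [faceSign_insert_of_lt h, h2]
    ring
  · have h2 : faceSign k σ w = faceSign k (σ.erase v) w := by
      conv_lhs => rw [← h1]
      exact faceSign_insert_of_lt h
    rw [faceSign_insert_of_gt h hw, h2]
    ring

theorem simplexBoundary_single (σ : Finset V) (a : k) :
    simplexBoundary k (Finsupp.single σ a) =
      ∑ v ∈ σ, Finsupp.single (σ.erase v) (a * faceSign k σ v) := by
  simp [simplexBoundary, Finset.smul_sum]

theorem coneOp_single (w : V) (σ : Finset V) (a : k) :
    coneOp k w (Finsupp.single σ a) =
      if w ∈ σ then 0 else Finsupp.single (insert w σ) (a * faceSign k σ w) := by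
  rw [coneOp, Finsupp.linearCombination_single]
  split_ifs <;> simp

/-- The cone operator is a contracting homotopy of the full simplex. -/
theorem simplexBoundary_coneOp (w : V) (z : Finset V →₀ k) :
    simplexBoundary k (coneOp k w z) + coneOp k w (simplexBoundary k z) = z := by
  induction z using Finsupp.induction_linear with
  | zero => simp
  | add f g hf hg =>
    simp only [map_add]
    conv_rhs => rw [← hf, ← hg]
    abel
  | single σ a =>
    rw [simplexBoundary_single, coneOp_single, map_sum]
    simp only [coneOp_single]
    by_cases hw : w ∈ σ
    · rw [if_pos hw, map_zero, zero_add, Finset.sum_eq_single_of_mem w hw]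
      · rw [if_neg (Finset.notMem_erase w σ), Finset.insert_erase hw, faceSign_erase_self, mul_assoc,
          faceSign_mul_self, mul_one]
      · intro v _ hvw
        rw [if_pos (Finset.mem_erase.2 ⟨hvw.symm, hw⟩)]
    · rw [if_neg hw, simplexBoundary_single, Finset.sum_insert hw, faceSign_insert_self, mul_assoc,
        faceSign_mul_self, mul_one, Finset.erase_insert hw, add_assoc, ← Finset.sum_add_distrib,
        Finset.sum_eq_zero, add_zero]
      intro v hv
      have hvw : v ≠ w := fun h => hw (h ▸ hv)
      rw [if_neg fun h => hw (Finset.mem_of_mem_erase h), Finset.erase_insert_of_ne hvw.symm,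
        mul_assoc, mul_assoc, faceSign_anticomm hv hw, ← Finsupp.single_add]
      simp

/-- A nonempty simplex is, up to sign, a cone over a smaller one, so the homotopy formula reduces
the claim to that smaller simplex. -/
theorem simplexBoundary_simplexBoundary (z : Finset V →₀ k) :
    simplexBoundary k (simplexBoundary k z) = 0 := by
  induction z using Finsupp.induction_linear with
  | zero => simp
  | add f g hf hg => simp [hf, hg]
  | single σ a =>
    induction σ using Finset.induction_on generalizing a with
    | empty => simp [simplexBoundary_single]
    | insert w σ hw ih =>
      have h1 : Finsupp.single (insert w σ) a =
          coneOp k w (Finsupp.single σ (a * faceSign k σ w)) := by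
        rw [coneOp_single, if_neg hw, mul_assoc, faceSign_mul_self, mul_one]
      have h2 := simplexBoundary_coneOp w (Finsupp.single σ (a * faceSign k σ w))
      have h3 := simplexBoundary_coneOp w
        (simplexBoundary k (Finsupp.single σ (a * faceSign k σ w)))
      rw [ih, map_zero, add_zero] at h3
      rw [h1, eq_sub_of_add_eq h2, map_sub, h3, sub_self]

/-- A linear map sends chains supported on `s` to chains supported on `t` as soon as it does so for
the faces in `s`. -/
theorem map_mem_supported {ι κ : Type*} (f : (ι →₀ k) →ₗ[k] (κ →₀ k)) {s : Set ι} {t : Set κ}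
    (h : ∀ i ∈ s, f (Finsupp.single i 1) ∈ Finsupp.supported k k t) {z : ι →₀ k}
    (hz : z ∈ Finsupp.supported k k s) : f z ∈ Finsupp.supported k k t := by
  rw [Finsupp.supported_eq_span_single] at hz
  have : Submodule.span k ((fun i => Finsupp.single i (1 : k)) '' s) ≤
      (Finsupp.supported k k t).comap f := by
    rw [Submodule.span_le]
    rintro _ ⟨i, hi, rfl⟩
    exact h i hi
  exact this hz

theorem simplexBoundary_mem_supported {s t : Set (Finset V)}
    (h : ∀ σ ∈ s, ∀ v ∈ σ, σ.erase v ∈ t) {z : Finset V →₀ k}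
    (hz : z ∈ Finsupp.supported k k s) : simplexBoundary k z ∈ Finsupp.supported k k t := by
  refine map_mem_supported _ (fun σ hσ => ?_) hz
  rw [simplexBoundary_single]
  exact Submodule.sum_mem _ fun v hv => Finsupp.single_mem_supported k _ (h σ hσ v hv)

theorem coneOp_mem_supported {w : V} {s t : Set (Finset V)}
    (h : ∀ σ ∈ s, w ∉ σ → insert w σ ∈ t) {z : Finset V →₀ k}
    (hz : z ∈ Finsupp.supported k k s) : coneOp k w z ∈ Finsupp.supported k k t := by
  refine map_mem_supported _ (fun σ hσ => ?_) hz
  rw [coneOp_single]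
  split_ifs with hw
  · exact Submodule.zero_mem _
  · exact Finsupp.single_mem_supported k _ (h σ hσ hw)

/-- The subcomplex induced on the vertex set `W` can be reduced to a cone by removing, one after the
other, vertices `v` dominated by another vertex `w`. -/
inductive Dismantlable (Δ : PreAbstractSimplicialComplex V) : Finset V → Prop
  -- Allowing `σ = ∅` makes `{w}` a face, as acyclicity of the augmented complex requires.
  | cone (W : Finset V) (w : V) (hw : w ∈ W)
      (h : ∀ σ ⊆ W, σ ∈ Δ.faces ∨ σ = ∅ → insert w σ ∈ Δ.faces) : Dismantlable Δ W
  | step (W : Finset V) (v w : V) (hw : w ∈ W) (hvw : w ≠ v)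
      (h : ∀ σ ⊆ W, σ ∈ Δ.faces → v ∈ σ → insert w σ ∈ Δ.faces)
      (hW : Dismantlable Δ (W.erase v)) : Dismantlable Δ W

/-- The faces with `t` vertices of the subcomplex induced on `W`, including the empty face. -/
def inducedFaces (Δ : PreAbstractSimplicialComplex V) (W : Finset V) (t : ℕ) : Set (Finset V) :=
  {σ | (σ ∈ Δ.faces ∨ σ = ∅) ∧ σ ⊆ W ∧ σ.card = t}

/-- A dismantlable induced subcomplex is acyclic. -/
theorem Dismantlable.exists_simplexBoundary_eq {Δ : PreAbstractSimplicialComplex V} {W : Finset V}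
    (hW : Dismantlable Δ W) (t : ℕ) (z : Finset V →₀ k)
    (hz : z ∈ Finsupp.supported k k (inducedFaces Δ W t)) (hbz : simplexBoundary k z = 0) :
    ∃ y ∈ Finsupp.supported k k (inducedFaces Δ W (t + 1)), simplexBoundary k y = z := by
  induction hW generalizing z with
  | cone W w hw h =>
    refine ⟨coneOp k w z, coneOp_mem_supported ?_ hz, ?_⟩
    · rintro σ ⟨hσ, hσW, rfl⟩ hwσ
      exact ⟨Or.inl (h σ hσW hσ), Finset.insert_subset hw hσW, Finset.card_insert_of_notMem hwσ⟩
    · simpa [hbz] using simplexBoundary_coneOp w z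
  | step W v w hw hvw h hW ih =>
    -- The part `p` of the cycle through `v` is pushed off `v` by subtracting the boundary of its
    -- cone with apex `w`, which exists because `w` dominates `v`. What remains is `p'` plus the
    -- cone over `∂p`.
    let p := z.filter (v ∈ ·)
    let p' := z.filter (v ∉ ·)
    have hpp : p + p' = z := Finsupp.filter_add_filter_not z _
    have hp : p ∈ Finsupp.supported k k {σ | σ ∈ inducedFaces Δ W t ∧ v ∈ σ} := by
      rw [Finsupp.mem_supported'] at hz ⊢
      intro σ hσ
      by_cases hv : v ∈ σ
      · simp only [p, Finsupp.filter_apply, if_pos hv]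
        exact hz σ fun h => hσ ⟨h, hv⟩
      · simp only [p, Finsupp.filter_apply, if_neg hv]
    have hp' : p' ∈ Finsupp.supported k k {σ | σ ∈ inducedFaces Δ W t ∧ v ∉ σ} := by
      rw [Finsupp.mem_supported'] at hz ⊢
      intro σ hσ
      by_cases hv : v ∈ σ
      · simp [p', hv]
      · simp only [p', Finsupp.filter_apply, if_pos hv]
        exact hz σ fun h => hσ ⟨h, hv⟩
    have hface : ∀ σ ∈ inducedFaces Δ W t, v ∈ σ → insert w σ ∈ Δ.faces := fun σ hσ hv =>
      h σ hσ.2.1 (hσ.1.resolve_right fun h => by simp [h] at hv) hv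
    have hcp : coneOp k w p ∈ Finsupp.supported k k (inducedFaces Δ W (t + 1)) := by
      refine coneOp_mem_supported ?_ hp
      rintro σ ⟨hσ, hv⟩ hwσ
      exact ⟨Or.inl (hface σ hσ hv), Finset.insert_subset hw hσ.2.1, by
        rw [Finset.card_insert_of_notMem hwσ, hσ.2.2]⟩
    have hbp : simplexBoundary k p ∈ Finsupp.supported k k
        ({σ | σ ⊆ W ∧ insert w σ ∈ Δ.faces ∧ σ.card + 1 = t} ∩ {σ | v ∉ σ}) := by
      rw [Finsupp.supported_inter]
      refine ⟨simplexBoundary_mem_supported ?_ hp, ?_⟩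
      · rintro σ ⟨hσ, hv⟩ x hx
        refine ⟨(Finset.erase_subset x σ).trans hσ.2.1, ?_, ?_⟩
        · exact (Δ.isRelLowerSet_faces (hface σ hσ hv)).2
            (Finset.insert_subset_insert w (Finset.erase_subset x σ)) (Finset.insert_nonempty _ _)
        · rw [Finset.card_erase_add_one hx, hσ.2.2]
      -- Since `z` is a cycle, `∂p` is also `-∂p'`, and no face of `p'` contains `v`.
      · have h1 : simplexBoundary k p = -simplexBoundary k p' := by
          rw [eq_neg_iff_add_eq_zero, ← map_add, hpp, hbz]
        rw [h1]
        refine neg_mem (simplexBoundary_mem_supported ?_ hp')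
        rintro σ ⟨-, hv⟩ x - hv'
        exact hv (Finset.mem_of_mem_erase hv')
    obtain ⟨y, hy, hyz⟩ := ih (z - simplexBoundary k (coneOp k w p)) (by
      have h1 : z - simplexBoundary k (coneOp k w p) = p' + coneOp k w (simplexBoundary k p) := by
        rw [eq_sub_of_add_eq (simplexBoundary_coneOp w p)]
        nth_rewrite 1 [← hpp]
        abel
      rw [h1]
      refine add_mem (Finsupp.supported_mono ?_ hp') (coneOp_mem_supported ?_ hbp)
      · rintro σ ⟨hσ, hv⟩
        exact ⟨hσ.1, Finset.subset_erase.2 ⟨hσ.2.1, hv⟩, hσ.2.2⟩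
      · rintro σ ⟨⟨hσW, hσ, hc⟩, hv⟩ hwσ
        exact ⟨Or.inl hσ, Finset.subset_erase.2 ⟨Finset.insert_subset hw hσW, by
          simp [hvw.symm, show v ∉ σ from hv]⟩, by rw [Finset.card_insert_of_notMem hwσ, hc]⟩)
      (by rw [map_sub, hbz, simplexBoundary_simplexBoundary, sub_zero])
    refine ⟨y + coneOp k w p, add_mem (Finsupp.supported_mono ?_ hy) hcp, by
      rw [map_add, hyz, sub_add_cancel]⟩
    rintro σ ⟨hσ, hσW, hc⟩
    exact ⟨hσ, hσW.trans (Finset.erase_subset v W), hc⟩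

end Chains

/-! ### Splitting the homogenized complex by multidegree -/

section Strands

variable {V : Type*} {n : ℕ} {k : Type*} [Field k] {label : V → Fin n →₀ ℕ}
  {Δ : PreAbstractSimplicialComplex V}

theorem faceLabel_mono {σ τ : Finset V} (h : σ ⊆ τ) : faceLabel label σ ≤ faceLabel label τ :=
  Finset.sup_mono h

theorem ChainModule.induction_on {t : ℕ} {P : ChainModule k n Δ t → Prop}
    (z : ChainModule k n Δ t) (zero : P 0) (add : ∀ x y, P x → P y → P (x + y))
    (single : ∀ σ w a, P (Finsupp.single σ (monomial w a))) : P z := by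
  induction z using Finsupp.induction_linear with
  | zero => exact zero
  | add x y hx hy => exact add x y hx hy
  | single σ p =>
    induction p using MvPolynomial.induction_on' with
    | monomial w a => exact single σ w a
    | add p q hp hq => rw [Finsupp.single_add]; exact add _ _ hp hq

variable (k label Δ) in
/-- The part of degree `u` of a chain of the homogenized complex, as a chain of the simplex. -/
def strand (t : ℕ) (u : Fin n →₀ ℕ) : ChainModule k n Δ t →ₗ[k] (Finset V →₀ k) :=
  Finsupp.lsum k fun σ => if faceLabel label σ.1 ≤ u then
    Finsupp.lsingle σ.1 ∘ₗ lcoeff k (u - faceLabel label σ.1) else 0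

open Classical in
variable (k label Δ) in
/-- The homogenization in degree `u` of a chain of the simplex. -/
def homogenize (t : ℕ) (u : Fin n →₀ ℕ) : (Finset V →₀ k) →ₗ[k] ChainModule k n Δ t :=
  Finsupp.linearCombination k fun ρ => if h : ρ ∈ Δ.faces ∧ ρ.card = t + 1 then
    Finsupp.single ⟨ρ, h⟩ (monomial (u - faceLabel label ρ) 1) else 0

theorem strand_single_monomial {t : ℕ} (u : Fin n →₀ ℕ) (σ : FaceOfDim Δ t) (w : Fin n →₀ ℕ)
    (a : k) : strand k label Δ t u (Finsupp.single σ (monomial w a)) =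
      if w + faceLabel label σ.1 = u then Finsupp.single σ.1 a else 0 := by
  rw [strand, Finsupp.lsum_single]
  split_ifs with h1 h2 h2
  · simp [lcoeff, ← h2]
  · have : w ≠ u - faceLabel label σ.1 := by
      rintro rfl
      exact h2 (tsub_add_cancel_of_le h1)
    simp [lcoeff, this]
  · exact absurd (h2 ▸ le_add_self) h1
  · rfl

theorem homogenize_single_face {t : ℕ} (u : Fin n →₀ ℕ) (σ : FaceOfDim Δ t) (a : k) :
    homogenize k label Δ t u (Finsupp.single σ.1 a) =
      Finsupp.single σ (monomial (u - faceLabel label σ.1) a) := by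
  rw [homogenize, Finsupp.linearCombination_single, dif_pos σ.2, Finsupp.smul_single, smul_monomial,
    smul_eq_mul, mul_one]

/-- A chain of the homogenized complex is the sum of its homogeneous parts. -/
theorem exists_sum_homogenize_strand {t : ℕ} (z : ChainModule k n Δ t) :
    ∃ U : Finset (Fin n →₀ ℕ), ∀ U', U ⊆ U' →
      ∑ u ∈ U', homogenize k label Δ t u (strand k label Δ t u z) = z := by
  induction z using ChainModule.induction_on with
  | zero => exact ⟨∅, by simp⟩
  | add x y hx hy =>
    obtain ⟨U₁, h₁⟩ := hx
    obtain ⟨U₂, h₂⟩ := hy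
    refine ⟨U₁ ∪ U₂, fun U' hU' => ?_⟩
    simp only [map_add, Finset.sum_add_distrib]
    rw [h₁ U' (Finset.union_subset_left hU'), h₂ U' (Finset.union_subset_right hU')]
  | single σ w a =>
    refine ⟨{w + faceLabel label σ.1}, fun U' hU' => ?_⟩
    simp only [strand_single_monomial]
    rw [Finset.sum_eq_single_of_mem (w + faceLabel label σ.1) (hU' (Finset.mem_singleton_self _)),
      if_pos rfl, homogenize_single_face, add_tsub_cancel_right]
    intro u _ hu
    rw [if_neg hu.symm, map_zero]

theorem eq_zero_of_strand_eq_zero {t : ℕ} {z : ChainModule k n Δ t}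
    (h : ∀ u, strand k label Δ t u z = 0) : z = 0 := by
  obtain ⟨U, hU⟩ := exists_sum_homogenize_strand (label := label) z
  rw [← hU U subset_rfl]
  simp [h]

variable (label) in
/-- The vertices whose label divides the monomial of exponent `u`. -/
def verticesBelow [Fintype V] (u : Fin n →₀ ℕ) : Finset V :=
  Finset.univ.filter (label · ≤ u)

theorem faceLabel_le_iff [Fintype V] {u : Fin n →₀ ℕ} {σ : Finset V} :
    faceLabel label σ ≤ u ↔ σ ⊆ verticesBelow label u := by
  simp [faceLabel, verticesBelow, Finset.subset_iff]

theorem strand_mem_supported [Fintype V] {t : ℕ} (u : Fin n →₀ ℕ) (z : ChainModule k n Δ t) :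
    strand k label Δ t u z ∈
      Finsupp.supported k k (inducedFaces Δ (verticesBelow label u) (t + 1)) := by
  induction z using ChainModule.induction_on with
  | zero => simp
  | add x y hx hy => rw [map_add]; exact add_mem hx hy
  | single σ w a =>
    rw [strand_single_monomial]
    split_ifs with h
    · refine Finsupp.single_mem_supported k _ ⟨Or.inl σ.2.1, ?_, σ.2.2⟩
      rw [← faceLabel_le_iff, ← h]
      exact le_add_self
    · exact Submodule.zero_mem _

variable [LinearOrder V]

theorem boundary_single {t : ℕ} (σ : FaceOfDim Δ (t + 1)) (p : MvPolynomial (Fin n) k) :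
    boundary k label Δ t (Finsupp.single σ p) = ∑ v ∈ σ.1.attach,
      Finsupp.single (σ.erase v.1 v.2) (p * ((-1) ^ (σ.1.filter (· < v.1)).card *
          monomial (faceLabel label σ.1 - faceLabel label (σ.1.erase v.1)) 1)) := by
  simp only [boundary, Finsupp.linearCombination_single, Finset.smul_sum, Finsupp.smul_single,
    smul_eq_mul]

theorem boundary_single_monomial {t : ℕ} (σ : FaceOfDim Δ (t + 1)) (w : Fin n →₀ ℕ) (a : k) :
    boundary k label Δ t (Finsupp.single σ (monomial w a)) = ∑ v ∈ σ.1.attach,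
      Finsupp.single (σ.erase v.1 v.2) (monomial
        (w + (faceLabel label σ.1 - faceLabel label (σ.1.erase v.1))) (a * faceSign k σ.1 v)) := by
  rw [boundary_single]
  refine Finset.sum_congr rfl fun v _ => ?_
  have h : (-1 : MvPolynomial (Fin n) k) ^ (σ.1.filter (· < v.1)).card =
      C (faceSign k σ.1 v) := by
    simp [faceSign]
  rw [h, C_mul_monomial, monomial_mul, mul_one]

/-- The monomial entries of the differential compensate for the drop in the label, so multidegree is
preserved and only the signs remain. -/
theorem strand_boundary {t : ℕ} (u : Fin n →₀ ℕ) (z : ChainModule k n Δ (t + 1)) :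
    strand k label Δ t u (boundary k label Δ t z) =
      simplexBoundary k (strand k label Δ (t + 1) u z) := by
  induction z using ChainModule.induction_on with
  | zero => simp
  | add x y hx hy => simp [hx, hy]
  | single σ w a =>
    rw [boundary_single_monomial, map_sum, strand_single_monomial]
    have h : ∀ v ∈ σ.1, w + (faceLabel label σ.1 - faceLabel label (σ.1.erase v)) +
        faceLabel label (σ.1.erase v) = w + faceLabel label σ.1 := fun v _ => by
      rw [add_assoc, tsub_add_cancel_of_le (faceLabel_mono (Finset.erase_subset v σ.1))]
    simp only [strand_single_monomial]
    by_cases hu : w + faceLabel label σ.1 = u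
    · rw [if_pos hu, simplexBoundary_single, ← Finset.sum_attach σ.1]
      refine Finset.sum_congr rfl fun v _ => ?_
      exact if_pos ((h v.1 v.2).trans hu)
    · rw [if_neg hu, map_zero]
      refine Finset.sum_eq_zero fun v _ => ?_
      exact if_neg fun h' => hu ((h v.1 v.2).symm.trans h')

/-- The augmentation becomes the boundary onto the empty face, so exactness in degree 0 follows from
the same acyclicity. -/
theorem coeff_augmentation (u : Fin n →₀ ℕ) (z : ChainModule k n Δ 0) :
    simplexBoundary k (strand k label Δ 0 u z) =
      Finsupp.single ∅ (coeff u (augmentation k label Δ z)) := by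
  induction z using ChainModule.induction_on with
  | zero => simp
  | add x y hx hy => simp [hx, hy]
  | single σ w a =>
    obtain ⟨v, hv⟩ := Finset.card_eq_one.1 σ.2.2
    rw [strand_single_monomial, augmentation, Finsupp.linearCombination_single, smul_eq_mul,
      monomial_mul, mul_one, coeff_monomial]
    split_ifs
    · rw [hv, simplexBoundary_single, Finset.sum_singleton]
      simp [faceSign, Finset.filter_singleton, -Finsupp.single_mul]
    · simp

variable [Fintype V]

/-- On faces with label below `u` the truncated subtractions of exponents are genuine and telescope.
-/
theorem boundary_homogenize {t : ℕ} (u : Fin n →₀ ℕ) {y : Finset V →₀ k}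
    (hy : y ∈ Finsupp.supported k k (inducedFaces Δ (verticesBelow label u) (t + 2))) :
    boundary k label Δ t (homogenize k label Δ (t + 1) u y) =
      homogenize k label Δ t u (simplexBoundary k y) := by
  rw [Finsupp.supported_eq_span_single] at hy
  refine LinearMap.eqOn_span (f := (boundary k label Δ t).restrictScalars k ∘ₗ
    homogenize k label Δ (t + 1) u) (g := homogenize k label Δ t u ∘ₗ simplexBoundary k) ?_ hy
  rintro _ ⟨σ, ⟨hσ, hσu, hc⟩, rfl⟩
  have hσ' : σ ∈ Δ.faces := hσ.resolve_right fun h => by simp [h] at hc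
  let τ : FaceOfDim Δ (t + 1) := ⟨σ, hσ', hc⟩
  simp only [LinearMap.comp_apply, LinearMap.restrictScalars_apply]
  change boundary k label Δ t (homogenize k label Δ (t + 1) u (Finsupp.single τ.1 1)) = _
  rw [homogenize_single_face, boundary_single_monomial, simplexBoundary_single, map_sum,
    ← Finset.sum_attach σ]
  refine Finset.sum_congr rfl fun v _ => ?_
  change _ = homogenize k label Δ t u (Finsupp.single (τ.erase v.1 v.2).1 _)
  rw [homogenize_single_face]
  congr 2
  refine congrArg _ ?_
  exact tsub_add_tsub_cancel (faceLabel_le_iff.2 hσu) (faceLabel_mono (Finset.erase_subset _ _))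

/-- A chain all of whose strands are cycles is a boundary if the induced subcomplexes are
dismantlable. -/
theorem mem_range_boundary {t : ℕ}
    (hΔ : ∀ u, (verticesBelow label u).Nonempty → Dismantlable Δ (verticesBelow label u))
    {z : ChainModule k n Δ t} (hz : ∀ u, simplexBoundary k (strand k label Δ t u z) = 0) :
    z ∈ LinearMap.range (boundary k label Δ t) := by
  have h : ∀ u, ∃ y ∈ Finsupp.supported k k (inducedFaces Δ (verticesBelow label u) (t + 2)),
      simplexBoundary k y = strand k label Δ t u z := by
    intro u
    -- With no vertex below `u` the induced complex is not acyclic at the empty face, but strands of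
    -- nonempty faces vanish there.
    rcases (verticesBelow label u).eq_empty_or_nonempty with hu | hu
    · refine ⟨0, Submodule.zero_mem _, ?_⟩
      have h1 := strand_mem_supported (label := label) u z
      rw [hu, Finsupp.mem_supported'] at h1
      ext σ
      rw [map_zero, h1 σ]
      · rfl
      · rintro ⟨-, h2, h3⟩
        simp [Finset.subset_empty.mp h2] at h3
    · exact (hΔ u hu).exists_simplexBoundary_eq (t + 1) _ (strand_mem_supported u z) (hz u)
  choose y hy hyz using h
  obtain ⟨U, hU⟩ := exists_sum_homogenize_strand (label := label) z
  refine ⟨∑ u ∈ U, homogenize k label Δ (t + 1) u (y u), ?_⟩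
  rw [map_sum]
  refine (Finset.sum_congr rfl fun u _ => ?_).trans (hU U subset_rfl)
  rw [boundary_homogenize u (hy u), hyz]

/-- The criterion for a labeled simplicial complex to support a free resolution. -/
theorem isFreeResolution_of_dismantlable (hvert : ∀ v, {v} ∈ Δ.faces)
    (hΔ : ∀ u, (verticesBelow label u).Nonempty → Dismantlable Δ (verticesBelow label u)) :
    IsFreeResolution (Ideal.span (Set.range fun v => monomial (label v) (1 : k)))
      (ChainModule k n Δ) (boundary k label Δ) (augmentation k label Δ) := by
  refine ⟨fun j => inferInstance, fun j => inferInstance, ⟨Fintype.card V, fun j hj => ?_⟩, ?_,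
    fun z => ?_, fun j z => ?_⟩
  · have : IsEmpty (FaceOfDim Δ j) :=
      ⟨fun σ => by have := σ.2.2 ▸ Finset.card_le_univ σ.1; omega⟩
    infer_instance
  · rw [augmentation, Finsupp.range_linearCombination]
    congr 1
    ext p
    constructor
    · rintro ⟨σ, rfl⟩
      obtain ⟨v, hv⟩ := Finset.card_eq_one.1 σ.2.2
      exact ⟨v, by simp [hv, faceLabel]⟩
    · rintro ⟨v, rfl⟩
      exact ⟨⟨{v}, hvert v, rfl⟩, by simp [faceLabel]⟩
  · constructor
    · intro hz
      exact mem_range_boundary hΔ fun u => by rw [coeff_augmentation, hz, coeff_zero,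
        Finsupp.single_zero]
    · rintro ⟨y, rfl⟩
      ext u
      have h := coeff_augmentation (label := label) u (boundary k label Δ 0 y)
      rw [strand_boundary, simplexBoundary_simplexBoundary] at h
      simpa using (Finsupp.single_eq_zero.1 h.symm)
  · constructor
    · intro hz
      exact mem_range_boundary hΔ fun u => by rw [← strand_boundary, hz, map_zero]
    · rintro ⟨y, rfl⟩
      refine eq_zero_of_strand_eq_zero (label := label) fun u => ?_
      rw [strand_boundary, strand_boundary, simplexBoundary_simplexBoundary]

/-- The criterion for a labeled simplicial complex to support a minimal free resolution. -/
theorem supportsMinimalFreeResolution_of_dismantlable (hvert : ∀ v, {v} ∈ Δ.faces)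
    (hΔ : ∀ u, (verticesBelow label u).Nonempty → Dismantlable Δ (verticesBelow label u))
    (hmin : ∀ σ ∈ Δ.faces, ∀ v ∈ σ, faceLabel label (σ.erase v) ≠ faceLabel label σ) :
    SupportsMinimalFreeResolution k label Δ
      (Ideal.span (Set.range fun v => monomial (label v) (1 : k))) := by
  -- The proper ideal is that of polynomials with zero constant term; a strict drop in the label
  -- puts every entry in it.
  refine (isFreeResolution_of_dismantlable hvert hΔ).isMinimalFreeResolution
    (J := RingHom.ker (constantCoeff (R := k) (σ := Fin n))) (RingHom.ker_ne_top _) ?_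
  intro j x
  have h : LinearMap.range (boundary k label Δ j) ≤
      RingHom.ker (constantCoeff (R := k) (σ := Fin n)) • ⊤ := by
    rw [boundary, Finsupp.range_linearCombination, Submodule.span_le]
    rintro _ ⟨σ, rfl⟩
    refine Submodule.sum_mem _ fun v _ => ?_
    rw [← mul_one (_ * _), ← smul_eq_mul, ← Finsupp.smul_single]
    refine Submodule.smul_mem_smul ?_ Submodule.mem_top
    refine Ideal.mul_mem_left _ _ ?_
    rw [RingHom.mem_ker, constantCoeff_monomial, if_neg]
    rw [tsub_eq_zero_iff_le]
    exact fun h => hmin σ.1 σ.2.1 v.1 v.2 ((faceLabel_mono (Finset.erase_subset _ _)).antisymm h)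
  exact h ⟨x, rfl⟩

end Strands

/-! ### Unit entries from triangles and edges with equal labels -/

section Cancellation

variable {V : Type*} [LinearOrder V] [Finite V] {n : ℕ} {k : Type*} [Field k]
  {label : V → Fin n →₀ ℕ} {Δ : PreAbstractSimplicialComplex V}

/-- A labeled complex does not support a minimal free resolution if some triangle has the same label
as one of its edges. -/
theorem not_supportsMinimalFreeResolution {I : Ideal (MvPolynomial (Fin n) k)} (σ : FaceOfDim Δ 2)
    {v : V} (hv : v ∈ σ.1) (h : faceLabel label σ.1 ≤ faceLabel label (σ.1.erase v)) :
    ¬ SupportsMinimalFreeResolution k label Δ I := by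
  intro hI
  refine IsMinimalFreeResolution.not_isUnit_coord hI Finsupp.basisSingleOne
    Finsupp.basisSingleOne (σ.erase v hv) σ ?_
  have h1 : Finsupp.basisSingleOne.coord (σ.erase v hv)
      (boundary k label Δ 1 (Finsupp.basisSingleOne σ)) =
      (-1) ^ (σ.1.filter (· < v)).card := by
    rw [Finsupp.coe_basisSingleOne, boundary_single, Module.Basis.coord_apply]
    simp only [Finsupp.basisSingleOne_repr, LinearEquiv.refl_apply, Finsupp.coe_finsetSum,
      Finset.sum_apply]
    rw [Finset.sum_eq_single_of_mem ⟨v, hv⟩ (Finset.mem_attach _ _)]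
    · rw [Finsupp.single_eq_same, tsub_eq_zero_of_le h, one_mul]
      simp
    · intro w _ hw
      refine Finsupp.single_eq_of_ne fun h' => ?_
      have h2 : σ.1.erase v = σ.1.erase w.1 := congrArg Subtype.val h'
      have h3 : v ∈ σ.1.erase w.1 := Finset.mem_erase.2 ⟨fun h => hw (Subtype.ext h.symm), hv⟩
      rw [← h2] at h3
      exact Finset.notMem_erase v _ h3
  rw [h1]
  exact isUnit_one.neg.pow _

end Cancellation

/-! ### Vertices of the complex and generators of the power -/

section Vertices

variable {r q : ℕ}

instance : Finite (N r q) := by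
  refine Finite.of_injective (β := Fin q → Fin (r + 1)) (fun a i => ⟨a.coord i, ?_⟩) ?_
  · have := Finset.single_le_sum (f := a.coord) (fun _ _ => Nat.zero_le _) (Finset.mem_univ i)
    rw [a.sum_eq] at this
    omega
  · intro a b h
    ext i
    exact congrArg Fin.val (congrFun h i)

/-- The vertex `a + e_i`. -/
def N.addSingle (a : N r q) (i : Fin q) : N (r + 1) q :=
  ⟨a.coord + Pi.single i 1, by simp [Finset.sum_add_distrib, a.sum_eq]⟩

theorem N.exists_eq_addSingle (a : N (r + 1) q) : ∃ (b : N r q) (i : Fin q), a = b.addSingle i := by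
  obtain ⟨i, hi⟩ : ∃ i, a.coord i ≠ 0 := by
    by_contra! h
    have := a.sum_eq
    simp [h] at this
  have h : a.coord - Pi.single i 1 + Pi.single i 1 = a.coord := by
    ext j
    rcases eq_or_ne j i with rfl | hj
    · simp; omega
    · simp [hj]
  refine ⟨⟨a.coord - Pi.single i 1, ?_⟩, i, N.ext h.symm⟩
  have h1 := a.sum_eq
  rw [← h] at h1
  simp only [Pi.add_apply, Finset.sum_add_distrib, Finset.sum_pi_single', Finset.mem_univ,
    if_true] at h1
  simpa using h1

instance : Unique (N 0 q) where
  default := ⟨0, by simp⟩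
  uniq a := by
    ext i
    exact Finset.sum_eq_zero_iff.1 a.sum_eq i (Finset.mem_univ i)

theorem N.coord_le (a : N r q) (i : Fin q) : a.coord i ≤ r :=
  (Finset.single_le_sum (f := a.coord) (fun _ _ => Nat.zero_le _) (Finset.mem_univ i)).trans_eq
    a.sum_eq

theorem powerLabel_addSingle {n : ℕ} (m : Fin q → Fin n →₀ ℕ) (a : N r q) (i : Fin q) :
    powerLabel m (r + 1) (a.addSingle i) = powerLabel m r a + m i := by
  simp [powerLabel, N.addSingle, add_smul, Finset.sum_add_distrib, Pi.single_apply, ite_smul]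

/-- The power of a monomial ideal is generated by the labels of the vertices. -/
theorem span_powerLabel {k : Type*} [Field k] {n : ℕ} (m : Fin q → Fin n →₀ ℕ) (r : ℕ) :
    Ideal.span (Set.range fun a : N r q => monomial (powerLabel m r a) (1 : k)) =
      Ideal.span (Set.range fun i => monomial (m i) (1 : k)) ^ r := by
  induction r with
  | zero =>
    rw [pow_zero, Ideal.one_eq_top, Set.range_unique]
    have : powerLabel m 0 default = 0 := by
      simp [powerLabel, show (default : N 0 q).coord = 0 from rfl]
    rw [this, monomial_zero', C_1, Ideal.span_singleton_one]
  | succ r ih =>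
    rw [pow_succ, ← ih, Ideal.span_mul_span']
    congr 1
    ext p
    rw [Set.mem_mul]
    constructor
    · rintro ⟨a, rfl⟩
      obtain ⟨b, i, rfl⟩ := a.exists_eq_addSingle
      exact ⟨_, ⟨b, rfl⟩, _, ⟨i, rfl⟩, by simp [powerLabel_addSingle, monomial_mul]⟩
    · rintro ⟨_, ⟨b, rfl⟩, _, ⟨i, rfl⟩, rfl⟩
      exact ⟨b.addSingle i, by simp [powerLabel_addSingle, monomial_mul]⟩

theorem singleton_mem_L {a : N r q} {i : Fin q} (h : a ∈ firstLayer r q i ∨ a ∈ secondLayer r q i) :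
    {a} ∈ (L r q).faces :=
  ⟨Finset.singleton_nonempty a, i, by simpa using h⟩

/-- A nonempty set of vertices inside one layer spans a simplex. -/
theorem dismantlable_of_subset_layer {W : Finset (N r q)} (hW : W.Nonempty) {i : Fin q}
    (h : (W : Set (N r q)) ⊆ firstLayer r q i ∨ (W : Set (N r q)) ⊆ secondLayer r q i) :
    Dismantlable (L r q) W := by
  obtain ⟨w, hw⟩ := hW
  refine Dismantlable.cone W w hw fun σ hσ _ => ⟨Finset.insert_nonempty w σ, i, ?_⟩
  have h1 : ((insert w σ : Finset (N r q)) : Set (N r q)) ⊆ W :=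
    Finset.coe_subset.2 (Finset.insert_subset hw hσ)
  exact h.imp h1.trans h1.trans

end Vertices

/-! ### Faces containing a midpoint -/

section Obstruction

variable {r q : ℕ}

/-- The midpoint of two vertices has a label dividing the least common multiple of their labels. -/
theorem powerLabel_le_sup {n : ℕ} (m : Fin q → Fin n →₀ ℕ) {v w₁ w₂ : N r q}
    (h : ∀ i, 2 * v.coord i = w₁.coord i + w₂.coord i) :
    powerLabel m r v ≤ powerLabel m r w₁ ⊔ powerLabel m r w₂ := by
  intro x
  have h1 : 2 * powerLabel m r v x = powerLabel m r w₁ x + powerLabel m r w₂ x := by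
    simp only [powerLabel, Finsupp.coe_finsetSum, Finset.sum_apply, Finsupp.smul_apply, smul_eq_mul,
      Finset.mul_sum, ← Finset.sum_add_distrib]
    exact Finset.sum_congr rfl fun i _ => by rw [← mul_assoc, h, add_mul]
  rw [Finsupp.sup_apply]
  omega

/-- A face of `𝕃 ^ r _ q` containing the midpoint of two of its other vertices keeps `𝕃 ^ r _ q` from
supporting a minimal free resolution. -/
theorem not_supports_of_midpoint {k : Type*} [Field k] {n : ℕ} (m : Fin q → Fin n →₀ ℕ)
    {I : Ideal (MvPolynomial (Fin n) k)} {v w₁ w₂ : N r q} (hw : w₁ ≠ w₂)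
    (h : ∀ i, 2 * v.coord i = w₁.coord i + w₂.coord i)
    (i : Fin q) (hv : v ∈ firstLayer r q i) (h₁ : w₁ ∈ firstLayer r q i)
    (h₂ : w₂ ∈ firstLayer r q i) :
    ¬ SupportsMinimalFreeResolution k (powerLabel m r) (L r q) I := by
  have hv₁ : v ≠ w₁ := by
    rintro rfl
    exact hw (N.ext (funext fun i => by have := h i; omega))
  have hv₂ : v ≠ w₂ := by
    rintro rfl
    exact hw (N.ext (funext fun i => by have := h i; omega))
  refine not_supportsMinimalFreeResolution (v := v)
    ⟨{v, w₁, w₂}, ⟨Finset.insert_nonempty _ _, i, Or.inl ?_⟩, ?_⟩ ?_ ?_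
  · intro a ha
    simp only [Finset.coe_insert, Finset.coe_singleton, Set.mem_insert_iff,
      Set.mem_singleton_iff] at ha
    rcases ha with rfl | rfl | rfl <;> assumption
  · rw [Finset.card_eq_three]
    exact ⟨v, w₁, w₂, hv₁, hv₂, hw, rfl⟩
  · exact Finset.mem_insert_self _ _
  · rw [Finset.erase_insert (by simp [hv₁, hv₂])]
    simp only [faceLabel, Finset.sup_insert, Finset.sup_singleton]
    exact sup_le (powerLabel_le_sup m h) le_rfl

theorem not_supports_two {k : Type*} [Field k] (hr : 5 ≤ r) {n : ℕ} (m : Fin 2 → Fin n →₀ ℕ)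
    {I : Ideal (MvPolynomial (Fin n) k)} :
    ¬ SupportsMinimalFreeResolution k (powerLabel m r) (L r 2) I := by
  -- Three consecutive points of the first layer at index 0: first coordinates are at most `r - 1`,
  -- and second coordinates at most 3, which is at most `⌈r / 2⌉` exactly because `r ≥ 5`.
  refine not_supports_of_midpoint m (v := ⟨![r - 2, 2], by simp; omega⟩)
    (w₁ := ⟨![r - 1, 1], by simp; omega⟩) (w₂ := ⟨![r - 3, 3], by simp; omega⟩) ?_ ?_ 0 ?_ ?_ ?_
  · intro h
    have := congrFun (congrArg N.coord h) 1
    simp at this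
  · intro i
    fin_cases i
    · simp; omega
    · simp
  all_goals
    refine ⟨?_, fun j hj => ?_⟩
    · simp <;> omega
    · fin_cases j
      · simp at hj
      · simp; omega

theorem not_supports_of_three_le {k : Type*} [Field k] (hr : 3 ≤ r) (hq : 3 ≤ q) {n : ℕ}
    (m : Fin q → Fin n →₀ ℕ) {I : Ideal (MvPolynomial (Fin n) k)} :
    ¬ SupportsMinimalFreeResolution k (powerLabel m r) (L r q) I := by
  obtain ⟨r, rfl⟩ : ∃ t, r = t + 2 := ⟨r - 2, by omega⟩
  let i₀ : Fin q := ⟨0, by omega⟩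
  let i₁ : Fin q := ⟨1, by omega⟩
  let i₂ : Fin q := ⟨2, by omega⟩
  have h01 : i₀ ≠ i₁ := by simp [i₀, i₁]
  have h02 : i₀ ≠ i₂ := by simp [i₀, i₂]
  have h12 : i₁ ≠ i₂ := by simp [i₁, i₂]
  let a : N r q := ⟨Pi.single i₀ r, by simp⟩
  -- Here `r` is the old exponent minus 2. The coordinates away from `i₀` are at most 2, which is at
  -- most `⌈(r + 2) / 2⌉` since `r + 2 ≥ 3`.
  have key : ∀ i j : Fin q, i ≠ i₀ → j ≠ i₀ → (a.addSingle i).addSingle j ∈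
      firstLayer (r + 2) q i₀ := by
    intro i j hi hj
    constructor
    · simp [a, N.addSingle, hi.symm, hj.symm]
    · intro l hl
      simp only [a, N.addSingle, Pi.add_apply, Pi.single_apply, if_neg hl]
      split_ifs <;> omega
  refine not_supports_of_midpoint m (v := (a.addSingle i₁).addSingle i₂)
    (w₁ := (a.addSingle i₁).addSingle i₁) (w₂ := (a.addSingle i₂).addSingle i₂) ?_ ?_ i₀
    (key _ _ h01.symm h02.symm) (key _ _ h01.symm h01.symm) (key _ _ h02.symm h02.symm)
  · intro h
    have := congrFun (congrArg N.coord h) i₁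
    simp [N.addSingle, a, h12] at this
    omega
  · intro i
    simp only [N.addSingle, Pi.add_apply]
    ring

end Obstruction

/-! ### The extremal ideal -/

section Extremal

variable {r q : ℕ}

theorem faceLabel_apply {V : Type*} {n : ℕ} (label : V → Fin n →₀ ℕ) (σ : Finset V) (x : Fin n) :
    faceLabel label σ x = σ.sup fun v => label v x := by
  classical
  induction σ using Finset.induction_on with
  | empty => rfl
  | insert v σ hv ih =>
    rw [faceLabel] at ih
    rw [faceLabel, Finset.sup_insert, Finset.sup_insert, Finsupp.sup_apply, ih]

theorem faceLabel_erase_ne {V : Type*} [LinearOrder V] {n : ℕ} {label : V → Fin n →₀ ℕ}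
    {σ : Finset V} {v : V} (hv : v ∈ σ) (x : Fin n) (h0 : 0 < label v x)
    (h : ∀ w ∈ σ, w ≠ v → label w x < label v x) :
    faceLabel label (σ.erase v) ≠ faceLabel label σ := by
  refine fun heq => absurd (DFunLike.congr_fun heq x) (ne_of_lt ?_)
  rw [faceLabel_apply, faceLabel_apply]
  refine lt_of_lt_of_le ?_ (Finset.le_sup (f := fun v => label v x) hv)
  -- Positivity covers the case where the erased face is empty and has label 0.
  rw [Finset.sup_lt_iff (by simpa using h0)]
  exact fun w hw => h w (Finset.mem_of_mem_erase hw) (Finset.ne_of_mem_erase hw)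

variable (q) in
/-- The exponents of the generators of the extremal ideal: the variables are indexed by the subsets
of `Fin q`, and the `i`-th generator is the product of the variables of the subsets containing
`i`. -/
def extremalExponent (i : Fin q) : Fin (Fintype.card (Finset (Fin q))) →₀ ℕ :=
  Finsupp.equivFunOnFinite.symm fun x =>
    if i ∈ (Fintype.equivFin (Finset (Fin q))).symm x then 1 else 0

theorem extremalExponent_apply (i : Fin q) (A : Finset (Fin q)) :
    extremalExponent q i (Fintype.equivFin _ A) = if i ∈ A then 1 else 0 := by
  simp [extremalExponent]

/-- This turns minimality into combinatorics: a vertex can be separated from the rest of a face by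
any of the sums over subsets `A`. -/
theorem powerLabel_extremalExponent (a : N r q) (A : Finset (Fin q)) :
    powerLabel (extremalExponent q) r a (Fintype.equivFin _ A) = ∑ i ∈ A, a.coord i := by
  simp [powerLabel, extremalExponent_apply, Finsupp.coe_finsetSum]

theorem extremalExponent_le_one (i : Fin q) (x) : extremalExponent q i x ≤ 1 := by
  simp only [extremalExponent, Finsupp.equivFunOnFinite_symm_apply_apply]
  split_ifs <;> omega

theorem isMinimallyGenerated_extremal (k : Type*) [Field k] (q : ℕ) :
    IsMinimallyGenerated (Ideal.span (Set.range fun i => monomial (extremalExponent q i) (1 : k)))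
      (extremalExponent q) := by
  refine ⟨extremalExponent_le_one, rfl, fun i h => ?_⟩
  have h1 : monomial (extremalExponent q i) (1 : k) ∈
      Ideal.span ((fun s => monomial s (1 : k)) '' (extremalExponent q '' {i}ᶜ)) := by
    rw [Set.image_image, h]
    exact Ideal.subset_span ⟨i, rfl⟩
  rw [mem_ideal_span_monomial_image] at h1
  obtain ⟨_, ⟨j, hj, rfl⟩, hji⟩ := h1 (extremalExponent q i) (by simp)
  -- The variable of `{j}` divides the `j`-th generator and no other.
  have h2 := hji (Fintype.equivFin _ {j})
  rw [extremalExponent_apply, extremalExponent_apply] at h2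
  simp [Ne.symm (show j ≠ i from hj)] at h2

/-- A criterion for `𝕃 ^ r _ q` to support a minimal free resolution of the power of the extremal
ideal. -/
theorem extremal_supports (k : Type*) [Field k]
    (hvert : ∀ a : N r q, ∃ i, a ∈ firstLayer r q i ∨ a ∈ secondLayer r q i)
    (hΔ : ∀ (W : Finset (N r q)) {n : ℕ} (m : Fin q → Fin n →₀ ℕ) (u : Fin n →₀ ℕ),
      (∀ i x, m i x ≤ 1) → (∀ a, a ∈ W ↔ powerLabel m r a ≤ u) → W.Nonempty →
      Dismantlable (L r q) W)
    (hmin : ∀ σ ∈ (L r q).faces, ∀ v ∈ σ, ∃ A : Finset (Fin q), 0 < ∑ i ∈ A, v.coord i ∧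
      ∀ w ∈ σ, w ≠ v → ∑ i ∈ A, w.coord i < ∑ i ∈ A, v.coord i) :
    ∃ (n : ℕ) (I : Ideal (MvPolynomial (Fin n) k)) (m : Fin q → Fin n →₀ ℕ),
      IsMinimallyGenerated I m ∧ SupportsMinimalFreeResolution k (powerLabel m r) (L r q) (I ^ r) := by
  refine ⟨_, _, _, isMinimallyGenerated_extremal k q, ?_⟩
  have := Fintype.ofFinite (N r q)
  rw [← span_powerLabel]
  refine supportsMinimalFreeResolution_of_dismantlable (fun a => ?_) (fun u => ?_) ?_
  · obtain ⟨i, hi⟩ := hvert a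
    exact singleton_mem_L hi
  · exact hΔ _ (extremalExponent q) u extremalExponent_le_one (by simp [verticesBelow])
  · intro σ hσ v hv
    obtain ⟨A, h0, hA⟩ := hmin σ hσ v hv
    refine faceLabel_erase_ne hv (Fintype.equivFin _ A) ?_ ?_
    · rwa [powerLabel_extremalExponent]
    · simpa only [powerLabel_extremalExponent] using hA

end Extremal

/-! ### One generator: a single vertex -/

section OneGenerator

theorem extremal_supports_of_one (k : Type*) [Field k] {r : ℕ} (hr : 1 ≤ r) :
    ∃ (n : ℕ) (I : Ideal (MvPolynomial (Fin n) k)) (m : Fin 1 → Fin n →₀ ℕ),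
      IsMinimallyGenerated I m ∧ SupportsMinimalFreeResolution k (powerLabel m r) (L r 1) (I ^ r) := by
  have h0 : ∀ a : N r 1, a.coord 0 = r := fun a => by simpa using a.sum_eq
  have hL : ∀ a : N r 1, a ∈ secondLayer r 1 0 := fun a => by
    change r - 1 ≤ a.coord 0
    rw [h0]
    omega
  refine extremal_supports k (fun a => ⟨0, Or.inr (hL a)⟩) (fun W _ _ _ _ _ hW =>
    dismantlable_of_subset_layer hW (Or.inr fun a _ => hL a)) fun σ _ v _ => ⟨{0}, ?_, ?_⟩
  · rw [Finset.sum_singleton, h0]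
    omega
  · intro w _ hwv
    refine absurd (N.ext (funext fun i => ?_)) hwv
    rw [Subsingleton.elim i 0, h0, h0]

end OneGenerator

/-! ### First power: a full simplex -/

section FirstPower

theorem extremal_supports_first_power (k : Type*) [Field k] {q : ℕ} (hq : 1 ≤ q) :
    ∃ (n : ℕ) (I : Ideal (MvPolynomial (Fin n) k)) (m : Fin q → Fin n →₀ ℕ),
      IsMinimallyGenerated I m ∧ SupportsMinimalFreeResolution k (powerLabel m 1) (L 1 q) (I ^ 1) := by
  let i₀ : Fin q := ⟨0, hq⟩
  have hL : ∀ a : N 1 q, a ∈ firstLayer 1 q i₀ := fun a => ⟨a.coord_le _, fun j _ => a.coord_le _⟩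
  refine extremal_supports k (fun a => ⟨i₀, Or.inl (hL a)⟩) (fun W _ _ _ _ _ hW =>
    dismantlable_of_subset_layer hW (Or.inl fun a _ => hL a)) fun σ _ v _ => ?_
  obtain ⟨b, i, rfl⟩ := v.exists_eq_addSingle
  obtain rfl := Subsingleton.elim b default
  refine ⟨{i}, by simp [N.addSingle], fun w _ hw => ?_⟩
  obtain ⟨b, j, rfl⟩ := w.exists_eq_addSingle
  obtain rfl := Subsingleton.elim b default
  have hij : i ≠ j := by
    rintro rfl
    exact hw rfl
  simp [N.addSingle, hij]

end FirstPower

/-! ### Second power -/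

section SecondPower

variable {q : ℕ}

/-- The vertex `e_i + e_j` of `𝕃 ^ 2 _ q`. -/
def N.pair (i j : Fin q) : N 2 q :=
  ((default : N 0 q).addSingle i).addSingle j

theorem N.exists_eq_pair (a : N 2 q) : ∃ i j, a = N.pair i j := by
  obtain ⟨b, j, rfl⟩ := a.exists_eq_addSingle
  obtain ⟨c, i, rfl⟩ := b.exists_eq_addSingle
  obtain rfl := Subsingleton.elim c default
  exact ⟨i, j, rfl⟩

theorem N.coord_pair (i j l : Fin q) :
    (N.pair i j).coord l = (if l = i then 1 else 0) + if l = j then 1 else 0 := by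
  have : (default : N 0 q).coord = 0 := rfl
  simp [N.pair, N.addSingle, Pi.single_apply, this]

theorem N.pair_comm (i j : Fin q) : N.pair i j = N.pair j i := by
  ext l
  rw [N.coord_pair, N.coord_pair, add_comm]

theorem powerLabel_pair {n : ℕ} (m : Fin q → Fin n →₀ ℕ) (i j : Fin q) :
    powerLabel m 2 (N.pair i j) = m i + m j := by
  have : powerLabel m 0 default = 0 := by
    simp [powerLabel, show (default : N 0 q).coord = 0 from rfl]
  rw [N.pair, powerLabel_addSingle, powerLabel_addSingle, this, zero_add]

/-- For `r = 2` both bounds in the first layer equal 1, so all first layers coincide and contain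
exactly the vertices `e_i + e_j` with `i ≠ j`. -/
theorem pair_mem_firstLayer {i j : Fin q} (h : i ≠ j) (l : Fin q) :
    N.pair i j ∈ firstLayer 2 q l := by
  have h1 : ∀ l, (N.pair i j).coord l ≤ 1 := fun l => by
    rw [N.coord_pair]
    split_ifs <;> omega
  exact ⟨h1 l, fun j _ => h1 j⟩

theorem pair_self_notMem_firstLayer (i l : Fin q) : N.pair i i ∉ firstLayer 2 q l := by
  rintro ⟨h1, h2⟩
  have h3 : (N.pair i i).coord i = 2 := by simp [N.coord_pair]
  rcases eq_or_ne i l with rfl | h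
  · rw [h3] at h1
    simp at h1
  · have := h2 i h
    omega

theorem pair_mem_secondLayer (i j : Fin q) : N.pair i j ∈ secondLayer 2 q i := by
  change 1 ≤ (N.pair i j).coord i
  simp [N.coord_pair]

theorem exists_eq_pair_of_mem_secondLayer {i : Fin q} {a : N 2 q} (ha : a ∈ secondLayer 2 q i) :
    ∃ j, a = N.pair i j := by
  obtain ⟨j, l, rfl⟩ := a.exists_eq_pair
  have h : 1 ≤ (N.pair j l).coord i := ha
  rw [N.coord_pair] at h
  by_cases hj : i = j
  · exact ⟨l, by rw [hj]⟩
  · by_cases hl : i = l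
    · exact ⟨j, by rw [hl, N.pair_comm]⟩
    · simp [hj, hl] at h

/-- A vertex set of `𝕃 ^ 2 _ q` induces a dismantlable subcomplex as soon as each vertex `2 e_i` in
it, unless it is the only vertex, is accompanied by a vertex `e_i + e_j` with `j ≠ i`. -/
theorem dismantlable_second_power {W : Finset (N 2 q)} (hW : W.Nonempty)
    (h : ∀ i, N.pair i i ∈ W → ∀ a ∈ W, a ≠ N.pair i i → ∃ j, j ≠ i ∧ N.pair i j ∈ W) :
    Dismantlable (L 2 q) W := by
  induction W using Finset.strongInduction with
  | H W ih =>
    by_cases hi : ∃ i, N.pair i i ∈ W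
    · obtain ⟨i, hi⟩ := hi
      by_cases ha : ∃ a ∈ W, a ≠ N.pair i i
      · obtain ⟨a, haW, hai⟩ := ha
        obtain ⟨j, hji, hj⟩ := h i hi a haW hai
        have hne : ∀ l j : Fin q, j ≠ l → ∀ i, N.pair l j ≠ N.pair i i := by
          intro l j hjl i heq
          have := pair_mem_firstLayer hjl.symm i
          rw [heq] at this
          exact pair_self_notMem_firstLayer i i this
        -- The only layer containing `2 e_i` is the second layer at `i`, which also contains `e_i +
        -- e_j`; hence `e_i + e_j` dominates `2 e_i`. Deleting `2 e_i` removes none of the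
        -- companions required by the hypothesis.
        refine Dismantlable.step W (N.pair i i) (N.pair i j) hj (hne _ _ hji _) ?_ ?_
        · rintro σ - ⟨-, l, hl | hl⟩ hiσ
          · exact absurd (hl hiσ) (pair_self_notMem_firstLayer i l)
          · refine ⟨Finset.insert_nonempty _ _, l, Or.inr ?_⟩
            obtain rfl : l = i := by
              by_contra hli
              have h1 : 1 ≤ (N.pair i i).coord l := hl hiσ
              simp [N.coord_pair, hli] at h1
            rw [Finset.coe_insert]
            exact Set.insert_subset (pair_mem_secondLayer _ _) hl
        · refine ih _ (Finset.erase_ssubset hi) ⟨a, Finset.mem_erase.2 ⟨hai, haW⟩⟩ ?_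
          intro l hl b hb hbl
          obtain ⟨j', hj', hlj'⟩ :=
            h l (Finset.mem_of_mem_erase hl) b (Finset.mem_of_mem_erase hb) hbl
          exact ⟨j', hj', Finset.mem_erase.2 ⟨hne _ _ hj' _, hlj'⟩⟩
      · push Not at ha
        refine dismantlable_of_subset_layer hW (i := i) (Or.inr fun a haW => ?_)
        rw [ha a haW]
        exact pair_mem_secondLayer i i
    · obtain ⟨a, ha⟩ := hW
      -- Any index serves, since the first layers coincide; the vertex shows that one exists.
      obtain ⟨l, -, -⟩ := a.exists_eq_pair
      refine dismantlable_of_subset_layer ⟨a, ha⟩ (i := l) (Or.inl fun b hb => ?_)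
      obtain ⟨i, j, rfl⟩ := b.exists_eq_pair
      exact pair_mem_firstLayer (fun hij => hi ⟨i, by rw [← hij] at hb; exact hb⟩) l

theorem extremal_supports_second_power (k : Type*) [Field k] (q : ℕ) :
    ∃ (n : ℕ) (I : Ideal (MvPolynomial (Fin n) k)) (m : Fin q → Fin n →₀ ℕ),
      IsMinimallyGenerated I m ∧ SupportsMinimalFreeResolution k (powerLabel m 2) (L 2 q) (I ^ 2) := by
  refine extremal_supports k (fun a => ?_) (fun W n m u hm hWu hW => ?_) ?_
  · obtain ⟨i, j, rfl⟩ := a.exists_eq_pair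
    exact ⟨i, Or.inr (pair_mem_secondLayer i j)⟩
  · refine dismantlable_second_power hW fun i hi a ha hai => ?_
    have key : ∀ j l, N.pair j l ∈ W → j ≠ i → ∃ j, j ≠ i ∧ N.pair i j ∈ W := by
      intro j l hjl hj
      refine ⟨j, hj, ?_⟩
      rw [hWu, powerLabel_pair] at hi hjl ⊢
      -- Where `m i x = 1`, the bound `2 * m i x ≤ u x` leaves room for the square-free sum; where
      -- `m i x = 0`, the bound on `m j + m l` suffices.
      intro x
      have h1 := hi x
      have h2 := hjl x
      have h3 := hm i x
      have h4 := hm j x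
      simp only [Finsupp.add_apply] at h1 h2 ⊢
      omega
    obtain ⟨j, l, rfl⟩ := a.exists_eq_pair
    by_cases hj : j = i
    · refine key l j (by rwa [N.pair_comm]) fun hl => hai (by rw [hj, hl])
    · exact key j l ha hj
  · rintro σ ⟨-, l, hl | hl⟩ v hv
    · obtain ⟨i, j, rfl⟩ := v.exists_eq_pair
      have hij : i ≠ j := by
        rintro rfl
        exact pair_self_notMem_firstLayer i l (hl hv)
      -- Among sums of two distinct unit vectors, only `e_i + e_j` has total 2 on `{i, j}`.
      refine ⟨{i, j}, ?_, fun w hw hwv => ?_⟩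
      · rw [Finset.sum_pair hij]
        simp [N.coord_pair]
      · obtain ⟨i', j', rfl⟩ := w.exists_eq_pair
        have hij' : i' ≠ j' := by
          rintro rfl
          exact pair_self_notMem_firstLayer i' l (hl hw)
        rw [Finset.sum_pair hij, Finset.sum_pair hij]
        simp only [N.coord_pair, if_true, hij, hij.symm, if_false]
        by_contra hlt
        apply hwv
        have h1 : (i = i' ∧ j = j') ∨ (i = j' ∧ j = i') := by
          split_ifs at hlt <;> omega
        rcases h1 with ⟨rfl, rfl⟩ | ⟨rfl, rfl⟩
        · rfl
        · exact N.pair_comm _ _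
    · obtain ⟨j, rfl⟩ := exists_eq_pair_of_mem_secondLayer (hl hv)
      -- In the second layer at `l` all vertices share the summand `e_l`, so the `j`-th coordinate
      -- singles out `e_l + e_j`, even when `j = l`.
      refine ⟨{j}, by simp [N.coord_pair], fun w hw hwv => ?_⟩
      obtain ⟨j', rfl⟩ := exists_eq_pair_of_mem_secondLayer (hl hw)
      have hj : j ≠ j' := by
        rintro rfl
        exact hwv rfl
      simp [N.coord_pair, hj]

end SecondPower

/-! ### Two generators, third and fourth powers -/

section TwoGenerators

variable {r : ℕ}

theorem N.coord_one (a : N r 2) : a.coord 1 = r - a.coord 0 := by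
  have := a.sum_eq
  rw [Fin.sum_univ_two] at this
  omega

theorem N.ext_two {a b : N r 2} (h : a.coord 0 = b.coord 0) : a = b := by
  ext i
  fin_cases i
  · exact h
  · simp [N.coord_one, h]

theorem mem_firstLayer_zero {a : N r 2} : a ∈ firstLayer r 2 0 ↔
    a.coord 0 ≤ max (r - 1) ((r + 1) / 2) ∧ r - a.coord 0 ≤ (r + 1) / 2 := by
  simp [firstLayer, Fin.forall_fin_two, N.coord_one]

theorem mem_firstLayer_one {a : N r 2} : a ∈ firstLayer r 2 1 ↔
    r - a.coord 0 ≤ max (r - 1) ((r + 1) / 2) ∧ a.coord 0 ≤ (r + 1) / 2 := by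
  simp [firstLayer, Fin.forall_fin_two, N.coord_one]

theorem mem_secondLayer_zero {a : N r 2} : a ∈ secondLayer r 2 0 ↔ r - 1 ≤ a.coord 0 := Iff.rfl

theorem mem_secondLayer_one {a : N r 2} : a ∈ secondLayer r 2 1 ↔ r - 1 ≤ r - a.coord 0 := by
  simp [secondLayer, N.coord_one]

/-- For `r = 3, 4`, the complex `𝕃 ^ r _ 2` is a path. -/
theorem mem_faces_two_iff (h3 : 3 ≤ r) (h4 : r ≤ 4) {σ : Finset (N r 2)} :
    σ ∈ (L r 2).faces ↔
      σ.Nonempty ∧ ∃ α, ∀ a ∈ σ, α ≤ a.coord 0 ∧ a.coord 0 ≤ α + 1 := by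
  have hle : ∀ a : N r 2, a.coord 0 ≤ r := fun a => a.coord_le 0
  refine and_congr_right fun hσ => ⟨?_, ?_⟩
  -- In terms of the first coordinate the layers are the edges `{r-2, r-1}`, `{r-1, r}`, `{1, 2}`,
  -- `{0, 1}`; for `3 ≤ r ≤ 4` these are all the edges of the path.
  · rintro ⟨i, h⟩
    fin_cases i
    · rcases h with h | h
      · refine ⟨r - 2, fun a ha => ?_⟩
        have := mem_firstLayer_zero.1 (h ha)
        omega
      · refine ⟨r - 1, fun a ha => ?_⟩
        have := mem_secondLayer_zero.1 (h ha)
        have := hle a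
        omega
    · rcases h with h | h
      · refine ⟨1, fun a ha => ?_⟩
        have := mem_firstLayer_one.1 (h ha)
        omega
      · refine ⟨0, fun a ha => ?_⟩
        have := mem_secondLayer_one.1 (h ha)
        omega
  · rintro ⟨α, hα⟩
    rcases Nat.lt_or_ge α 1 with h1 | h1
    · refine ⟨1, Or.inr fun a ha => mem_secondLayer_one.2 ?_⟩
      have := hα a ha
      omega
    · rcases Nat.lt_or_ge α (r - 1) with h2 | h2
      · rcases Nat.lt_or_ge α 2 with h5 | h5
        · refine ⟨1, Or.inl fun a ha => mem_firstLayer_one.2 ?_⟩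
          have := hα a ha
          omega
        · refine ⟨0, Or.inl fun a ha => mem_firstLayer_zero.2 ?_⟩
          have := hα a ha
          omega
      · refine ⟨0, Or.inr fun a ha => mem_secondLayer_zero.2 ?_⟩
        have := hα a ha
        omega

theorem dismantlable_two (h3 : 3 ≤ r) (h4 : r ≤ 4) {W : Finset (N r 2)} (hW : W.Nonempty)
    (h : ∀ a ∈ W, ∀ c ∈ W, ∀ b : N r 2, a.coord 0 ≤ b.coord 0 → b.coord 0 ≤ c.coord 0 → b ∈ W) :
    Dismantlable (L r 2) W := by
  induction W using Finset.strongInduction with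
  | H W ih =>
    obtain ⟨v, hv, hmax⟩ := W.exists_max_image (fun a => a.coord 0) hW
    by_cases ha : ∃ a ∈ W, a ≠ v
    · obtain ⟨a, haW, hav⟩ := ha
      have hlt : a.coord 0 < v.coord 0 :=
        lt_of_le_of_ne (hmax a haW) fun h => hav (N.ext_two h)
      have hvr := v.coord_le 0
      -- The end `v` of an interval of the path is dominated by its neighbour, which lies in `W` by
      -- convexity.
      let w : N r 2 := ⟨![v.coord 0 - 1, r - (v.coord 0 - 1)], by
        simp only [Fin.sum_univ_two, Matrix.cons_val_zero, Matrix.cons_val_one]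
        omega⟩
      have hw0 : w.coord 0 = v.coord 0 - 1 := rfl
      have hw : w ∈ W := h a haW v hv w (by omega) (by omega)
      refine Dismantlable.step W v w hw (fun h => by rw [h] at hw0; omega) ?_ ?_
      · intro σ hσW hσ hvσ
        rw [mem_faces_two_iff h3 h4] at hσ ⊢
        obtain ⟨-, α, hα⟩ := hσ
        refine ⟨Finset.insert_nonempty _ _, v.coord 0 - 1, fun b hb => ?_⟩
        rcases Finset.mem_insert.1 hb with rfl | hb
        · omega
        · have h1 := hmax b (hσW hb)
          have h2 := hα b hb
          have h5 := hα v hvσ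
          omega
      · refine ih _ (Finset.erase_ssubset hv) ⟨a, Finset.mem_erase.2 ⟨hav, haW⟩⟩ ?_
        intro b hb c hc x hbx hxc
        have hcW := Finset.mem_of_mem_erase hc
        refine Finset.mem_erase.2 ⟨?_, h b (Finset.mem_of_mem_erase hb) c hcW x hbx hxc⟩
        rintro rfl
        exact Finset.ne_of_mem_erase hc (N.ext_two ((hmax c hcW).antisymm hxc))
    · push Not at ha
      refine Dismantlable.cone W v hv fun σ hσ _ => ?_
      rw [mem_faces_two_iff h3 h4]
      refine ⟨Finset.insert_nonempty _ _, v.coord 0, fun b hb => ?_⟩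
      rw [ha b (Finset.insert_subset hv hσ hb)]
      omega

theorem extremal_supports_of_two (k : Type*) [Field k] (h3 : 3 ≤ r) (h4 : r ≤ 4) :
    ∃ (n : ℕ) (I : Ideal (MvPolynomial (Fin n) k)) (m : Fin 2 → Fin n →₀ ℕ),
      IsMinimallyGenerated I m ∧ SupportsMinimalFreeResolution k (powerLabel m r) (L r 2) (I ^ r) := by
  refine extremal_supports k (fun a => ?_) (fun W n m u hm hWu hW => ?_) ?_
  · have h : {a} ∈ (L r 2).faces := (mem_faces_two_iff h3 h4).2
      ⟨Finset.singleton_nonempty a, a.coord 0, by simp⟩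
    simpa using h.2
  · refine dismantlable_two h3 h4 hW fun a ha c hc b hab hbc => ?_
    rw [hWu] at ha hc ⊢
    intro x
    have hax := ha x
    have hcx := hc x
    have := a.coord_le 0
    have := b.coord_le 0
    have := c.coord_le 0
    simp only [powerLabel, Fin.sum_univ_two, Finsupp.add_apply, Finsupp.smul_apply, smul_eq_mul,
      N.coord_one] at hax hcx ⊢
    -- Each exponent is 0, `r`, the first coordinate or its complement in `r`: monotone along the
    -- path, hence bounded at `b` by its values at `a` and `c`.
    have h0 : m 0 x = 0 ∨ m 0 x = 1 := by have := hm 0 x; omega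
    have h1 : m 1 x = 0 ∨ m 1 x = 1 := by have := hm 1 x; omega
    rcases h0 with h0 | h0 <;> rcases h1 with h1 | h1 <;> rw [h0, h1] at hax hcx ⊢ <;> omega
  · intro σ hσ v hv
    obtain ⟨-, α, hα⟩ := (mem_faces_two_iff h3 h4).1 hσ
    have hv' := hα v hv
    have hne : ∀ w ∈ σ, w ≠ v → w.coord 0 ≠ v.coord 0 := fun w _ hwv h => hwv (N.ext_two h)
    have hvr := v.coord_le 0
    -- The upper end of an edge is separated by the first coordinate, the lower end by the second.
    -- The vertex `(r, 0)` must use the first even as a lower end, its second coordinate being 0.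
    by_cases hvα : v.coord 0 = α + 1 ∨ v.coord 0 = r
    · refine ⟨{0}, by rw [Finset.sum_singleton]; omega, fun w hw hwv => ?_⟩
      have h1 := hα w hw
      have h2 := hne w hw hwv
      have h5 := w.coord_le 0
      rw [Finset.sum_singleton, Finset.sum_singleton]
      omega
    · refine ⟨{1}, by rw [Finset.sum_singleton, N.coord_one]; omega, fun w hw hwv => ?_⟩
      have h1 := hα w hw
      have h2 := hne w hw hwv
      rw [Finset.sum_singleton, Finset.sum_singleton, N.coord_one, N.coord_one]
      omega

end TwoGenerators

end SimplicialPowers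

end

/-! ### The classification -/

theorem proposition7p8 (k : Type*) [Field k] (r q : ℕ) (hr : 1 ≤ r) (hq : 1 ≤ q) :
    (∃ (n : ℕ) (I : Ideal (MvPolynomial (Fin n) k)) (m : Fin q → Fin n →₀ ℕ),
      SimplicialPowers.IsMinimallyGenerated I m ∧
      SimplicialPowers.SupportsMinimalFreeResolution k (SimplicialPowers.powerLabel m r)
        (SimplicialPowers.L r q) (I ^ r)) ↔
    q = 1 ∨ (q = 2 ∧ r ≤ 4) ∨ (3 ≤ q ∧ r ≤ 2) := by
  constructor
  · rintro ⟨n, I, m, -, h⟩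
    by_contra hcon
    by_cases hq2 : q = 2
    · subst hq2
      exact SimplicialPowers.not_supports_two (by omega) m h
    · exact SimplicialPowers.not_supports_of_three_le (by omega) (by omega) m h
  · intro h
    by_cases hq1 : q = 1
    · subst hq1
      exact SimplicialPowers.extremal_supports_of_one k hr
    · rcases Nat.lt_or_ge r 3 with hr3 | hr3
      · interval_cases r
        · exact SimplicialPowers.extremal_supports_first_power k hq
        · exact SimplicialPowers.extremal_supports_second_power k q
      · obtain rfl : q = 2 := by omega
        exact SimplicialPowers.extremal_supports_of_two k hr3 (by omega)
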